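/- Let $\mathcal C$ be a bicategory and $W$ a class of $1$-morphisms of $\mathcal C$ (associators and unitors of $\mathcal C$ are omitted below) satisfying: - (BF1) every identity $\mathrm{id}_A$ is in $W$; - (BF2) $W$ is closed under composition; - (BF3) for all $f:X\to Z$ and $v:Y\to Z$ with $v\in W$ there are $v':P\to X$ in $W$, $f':P\to Y$ and an invertible $\rho:f\circ v'\Rightarrow v\circ f'$; - (BF4) (a) for all $u:Y\to Z$ in $W$, $f^1,f^2:X\to Y$ and $\alpha:u\circ f^1\Rightarrow u\circ f^2$ there are $v:D\to X$ in $W$ and $\beta:f^1\circ v\Rightarrow f^2\circ v$ with $\alpha\circ v=u\circ\beta$; (b) if $\alpha$ is invertible, $\beta$ can be taken invertible; (c) if $(D,v,\beta)$ and $(D',v',\beta')$ are both as in (a), there are $t:E\to D$, $t':E\to D'$ and an invertible $\zeta:v\circ t\Rightarrow v'\circ t'$ such that $v\circ t\in W$ and $(\beta'\circ t')\cdot(f^1\circ\zeta)=(f^2\circ\zeta)\cdot(\beta\circ t)$; - (BF5) a $1$-morphism isomorphic to one in $W$ is in $W$. A *set of choices* $C(W)$ is a choice of data $(P,v',f',\rho)$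 as in (BF3) for every pair $(f,v)$ with $v\in W$. A *set of choices* $D(W)$ is a choice of data $(D,v,\beta)$ as in (BF4a), with $\beta$ invertible if $\alpha$ is, for every $(u,f^1,f^2,\alpha)$ with $u\in W$; we call it the chosen lift of $\alpha$ along $u$. Fix $C(W)$. The bicategory of fractions $\mathcal C[W^{-1}]$ has the following ingredients. - *Objects*: those of $\mathcal C$. *Morphisms* $A\to B$: triples $(A',w,f)$ with $w:A'\to A$ in $W$ and $f:A'\to B$; the identity of $A$ is $(A,\mathrm{id}_A,\mathrm{id}_A)$, and $(B',v,g)\circ(A',w,f)=(P,w\circ v',g\circ f')$, where $(P,v',f',\rho)$ is chosen by $C(W)$ for $(f,v)$. - *$2$-morphisms* $(A^1,w^1,f^1)\Rightarrow(A^2,w^2,f^2)$: classes $[A^3,v^1,v^2,\alpha,\beta]$ with $v^i:A^3\to A^i$, $w^1\circ v^1\in W$, $\alpha:w^1\circ v^1\Rightarrow w^2\circ v^2$ invertible and $\beta:f^1\circ v^1\Rightarrow f^2\circ v^2$. Here $(A^3,v^1,v^2,\alpha,\beta)$ and $(A'^3,v'^1,v'^2,\alpha',\beta')$ are identified if there are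 $z:E\to A^3$, $z':E\to A'^3$ with $w^1\circ v^1\circ z\in W$ and invertible $\sigma^1:v'^1\circ z'\Rightarrow v^1\circ z$, $\sigma^2:v^2\circ z\Rightarrow v'^2\circ z'$ such that $(w^2\circ\sigma^2)\cdot(\alpha\circ z)\cdot(w^1\circ\sigma^1)=\alpha'\circ z'$ and $(f^2\circ\sigma^2)\cdot(\beta\circ z)\cdot(f^1\circ\sigma^1)=\beta'\circ z'$. - *Identity $2$-morphisms and unitors*: the classes of the evident diagrams; for the unitors these are given by the squares of $C(W)$. - *Vertical composition*. For representatives $(A^3,v^1,v^2,\alpha,\beta)$ and $(A'^3,u^2,u^3,\gamma,\delta)$, take the square chosen by $C(W)$ for $(w^2\circ v^2,\,w^2\circ u^2)$ and the chosen lift of its $2$-morphism along $w^2$. This gives $t^1:E\to A^3$, $t^2:E\to A'^3$ and an invertible $\rho:v^2\circ t^1\Rightarrow u^2\circ t^2$. The composite is $[E,v^1\circ t^1,u^3\circ t^2,\alpha'',\beta'']$, where $\alpha''$ is the pasting of $\alpha,\rho,\gamma$ and $\beta''$ that of $\beta,\rho,\delta$. - *Associators* $\underline h\circ(\underline g\circ\underline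 f)\Rightarrow(\underline h\circ\underline g)\circ\underline f$, for $\underline f=(A',u,f)$, $\underline g=(B',v,g)$, $\underline h=(C',w,h)$. Let $(A'',u^1,f^1,\delta)$, $(A''',u^2,l,\sigma)$, $(B'',v^1,g^1,\xi)$, $(\bar A,u^3,f^2,\eta)$ be chosen by $C(W)$ for $(f,v)$, $(g\circ f^1,w)$, $(g,w)$, $(f,v\circ v^1)$. Take the square chosen for $(u^1\circ u^2,u^3)$, the chosen lift along $v$ of its pasting with $\delta^{-1}$ and $\eta$, and then the chosen lift along $w$ of the pasting of the latter with $\sigma^{-1}$ and $\xi$. This gives $u^4:E\to A'''$, $u^5:E\to\bar A$ and invertible $\gamma:u^1u^2u^4\Rightarrow u^3u^5$, $\omega:f^1u^2u^4\Rightarrow v^1f^2u^5$, $\rho:lu^4\Rightarrow g^1f^2u^5$ such that $v\circ\omega$ is the pasting of $\delta^{-1},\gamma,\eta$, and $w\circ\rho$ is the pasting of $\sigma^{-1},\omega,\xi$. The associator is $[E,u^4,u^5,u\circ\gamma,h\circ\rho]$. - *Whiskering $\Delta\circ\underline f$*, for $\underline f=(A',w,f):A\to B$ and $\Delta=[B^3,u^1,u^2,\alpha,\beta]:(B^1,v^1,g^1)\Rightarrow(B^2,v^2,g^2)$.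 For $m=1,2$ let $(P^m,w'^m,f'^m,\rho^m)$ be chosen by $C(W)$ for $(f,v^m)$. Take the square chosen for $(f,v^m\circ u^m)$, then the square chosen for its left leg and $w'^m$, and the chosen lift along $v^m$ of the resulting pasting; this gives $t^m:D^m\to P^m$, $h^m:D^m\to B^3$ and an invertible $\sigma^m:f'^m\circ t^m\Rightarrow u^m\circ h^m$. Next take the square chosen for $(w'^1\circ t^1,w'^2\circ t^2)$ and the chosen lift along $v^1\circ u^1$ of the pasting of $\sigma^1,\rho^1$, this square, $\rho^2,\sigma^2,\alpha$; this gives $t^3:E\to D^1$, $t^4:E\to D^2$ and invertible $\varphi:w'^1t^1t^3\Rightarrow w'^2t^2t^4$, $\delta:h^1t^3\Rightarrow h^2t^4$. Then $\Delta\circ\underline f=[E,t^1t^3,t^2t^4,w\circ\varphi,\beta']$, with $\beta'$ the pasting of $\sigma^1$, $\delta$, $\beta$ and $(\sigma^2)^{-1}$. - *Whiskering $\underline g\circ\Gamma$*, for $\Gamma=[A^3,v^1,v^2,\alpha,\beta]:(A^1,w^1,f^1)\Rightarrow(A^2,w^2,f^2)$ and $\underline g=(B',u,g)$. For $m=1,2$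 let $(P^m,u^m,f'^m,\rho^m)$ be chosen by $C(W)$ for $(f^m,u)$. Take the squares chosen for $(v^1,u^1)$ and $(v^2,u^2)$, the square chosen for their legs into $A^3$, and the chosen lift $\lambda$ along $u$ of the pasting of these with $\rho^1,\rho^2,\beta$. The $2$-morphism $\underline g\circ\Gamma$ is the class of the diagram with legs into $P^1,P^2$ so obtained, with first component the pasting of the three squares and $\alpha$, and second component $g\circ\lambda$. - *Horizontal composition*: for $\Gamma:\underline f^1\Rightarrow\underline f^2$ and $\Delta:\underline g^1\Rightarrow\underline g^2$, the vertical composite of $\underline g^1\circ\Gamma$ followed by $\Delta\circ\underline f^2$. **Theorem.** Let $(\mathcal C,W)$ satisfy (BF1)–(BF5) and fix a set of choices $C(W)$. For every set of choices $D(W)$ the operations above are well defined on $2$-morphisms (independent of the representatives), and all sets of choices $D(W)$ give literally the same identities, unitors, associators, vertical compositions, whiskerings and horizontal compositions; that is, they give the same bicategory $\mathcal C[W^{-1}]$, not merely equivalent ones, so that it depends only on $C(W)$. Moreover, the associators, vertical composites and whiskerings are represented by the above diagrams formed from *any* data of the same shape, whether or not chosen by $C(W)$ and $D(W)$. Here the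 squares used for composing morphisms remain those of $C(W)$; $\gamma,\omega,\rho$, respectively $\delta$, respectively $\lambda$, have to satisfy the stated pasting equations; and the composite of the first leg with the left leg of the source has to lie in $W$. -/

import Mathlib

/-!
Pronk's bicategory of fractions.  Mathlib writes composition in a bicategory in diagrammatic order:
`f ≫ g` is the composite usually written `g ∘ f`, `f ◁ η` is `η ∘ f` and `η ▷ g` is `g ∘ η`.
The composition `η ⊗≫ θ` of 2-morphisms (and `≪⊗≫` of invertible ones) inserts the associators and
unitors of the ambient bicategory that are needed for `η` and `θ` to be composable.
-/

open CategoryTheory Bicategory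

universe w v u

namespace BiFrac

variable {K : Type u} [Bicategory.{w, v} K]

/-- A square `f ∘ fst ≅ v ∘ snd` whose leg `fst` lies in `W`. -/
structure OreSquare (W : MorphismProperty K) {X Y Z : K} (f : X ⟶ Z) (v : Y ⟶ Z) where
  pt : K
  fst : pt ⟶ X
  snd : pt ⟶ Y
  iso : fst ≫ f ≅ snd ≫ v
  fst_mem : W fst

/-- A morphism `v` in `W` and a 2-morphism `β : f₁ ∘ v ⇒ f₂ ∘ v` such that `α ∘ v = u ∘ β`. -/
structure CellLift (W : MorphismProperty K) {X Y Z : K} (u : Y ⟶ Z) (f₁ f₂ : X ⟶ Y)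
    (α : f₁ ≫ u ⟶ f₂ ≫ u) where
  pt : K
  v : pt ⟶ X
  v_mem : W v
  β : v ≫ f₁ ⟶ v ≫ f₂
  fac : v ◁ α = 𝟙 (v ≫ f₁ ≫ u) ⊗≫ β ▷ u ⊗≫ 𝟙 (v ≫ f₂ ≫ u)

/-- The axioms of a (right) bicalculus of fractions. -/
structure BF (W : MorphismProperty K) : Prop where
  bf1 : ∀ X : K, W (𝟙 X)
  bf2 : ∀ {X Y Z : K} (f : X ⟶ Y) (g : Y ⟶ Z), W f → W g → W (f ≫ g)
  bf3 : ∀ {X Y Z : K} (f : X ⟶ Z) (v : Y ⟶ Z), W v → Nonempty (OreSquare W f v)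
  /-- Parts (a) and (b) of the fourth axiom. -/
  bf4ab : ∀ {X Y Z : K} (u : Y ⟶ Z), W u → ∀ (f₁ f₂ : X ⟶ Y) (α : f₁ ≫ u ⟶ f₂ ≫ u),
    ∃ L : CellLift W u f₁ f₂ α, IsIso α → IsIso L.β
  /-- Part (c) of the fourth axiom. -/
  bf4c : ∀ {X Y Z : K} (u : Y ⟶ Z), W u → ∀ (f₁ f₂ : X ⟶ Y) (α : f₁ ≫ u ⟶ f₂ ≫ u)
    (L L' : CellLift W u f₁ f₂ α),
    ∃ (E : K) (t : E ⟶ L.pt) (t' : E ⟶ L'.pt) (ζ : t ≫ L.v ≅ t' ≫ L'.v),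
      W (t ≫ L.v) ∧
      ζ.hom ▷ f₁ ⊗≫ t' ◁ L'.β ⊗≫ 𝟙 ((t' ≫ L'.v) ≫ f₂) =
        𝟙 ((t ≫ L.v) ≫ f₁) ⊗≫ t ◁ L.β ⊗≫ ζ.hom ▷ f₂
  bf5 : ∀ {X Y : K} (f g : X ⟶ Y), W g → Nonempty (f ≅ g) → W f

/-- The choices `C(W)`: a square for every pair `(f, v)` with `v` in `W`. -/
structure CChoices (W : MorphismProperty K) where
  square : ∀ {X Y Z : K} (f : X ⟶ Z) (v : Y ⟶ Z), W v → OreSquare W f v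

/-- The choices `D(W)`: a lift, as in the fourth axiom, of every 2-morphism
`α : u ∘ f₁ ⇒ u ∘ f₂` with `u` in `W`, invertible when `α` is. -/
structure DChoices (W : MorphismProperty K) where
  lift : ∀ {X Y Z : K} (u : Y ⟶ Z), W u → ∀ (f₁ f₂ : X ⟶ Y) (α : f₁ ≫ u ⟶ f₂ ≫ u),
    CellLift W u f₁ f₂ α
  isIso_lift : ∀ {X Y Z : K} (u : Y ⟶ Z) (hu : W u) (f₁ f₂ : X ⟶ Y) (α : f₁ ≫ u ⟶ f₂ ≫ u),
    IsIso α → IsIso (lift u hu f₁ f₂ α).β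

/-- The 2-morphism of a lift as an isomorphism, when it is invertible. -/
noncomputable abbrev CellLift.isoβ {W : MorphismProperty K} {X Y Z : K} {u : Y ⟶ Z}
    {f₁ f₂ : X ⟶ Y} {α : f₁ ≫ u ⟶ f₂ ≫ u} (L : CellLift W u f₁ f₂ α) (hL : IsIso L.β) :
    L.v ≫ f₁ ≅ L.v ≫ f₂ :=
  @asIso _ _ _ _ L.β hL

/-! ### Morphisms and 2-morphisms -/

/-- A morphism `A ⟶ B` of the bicategory of fractions: `A ⟵ pt ⟶ B` with left leg in `W`. -/
structure Frac (W : MorphismProperty K) (A B : K) where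
  pt : K
  w : pt ⟶ A
  f : pt ⟶ B
  w_mem : W w

/-- A representative of a 2-morphism between two morphisms of the bicategory of fractions. -/
structure Rep {W : MorphismProperty K} {A B : K} (F₁ F₂ : Frac W A B) where
  pt : K
  v₁ : pt ⟶ F₁.pt
  v₂ : pt ⟶ F₂.pt
  α : v₁ ≫ F₁.w ≅ v₂ ≫ F₂.w
  β : v₁ ≫ F₁.f ⟶ v₂ ≫ F₂.f
  mem : W (v₁ ≫ F₁.w)

/-- The relation under which two representatives define the same 2-morphism. -/
def Rep.Rel {W : MorphismProperty K} {A B : K} {F₁ F₂ : Frac W A B} (r r' : Rep F₁ F₂) : Prop :=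
  ∃ (E : K) (z : E ⟶ r.pt) (z' : E ⟶ r'.pt) (σ₁ : z' ≫ r'.v₁ ≅ z ≫ r.v₁)
    (σ₂ : z ≫ r.v₂ ≅ z' ≫ r'.v₂),
    W (z ≫ r.v₁ ≫ F₁.w) ∧
    σ₁.hom ▷ F₁.w ⊗≫ z ◁ r.α.hom ⊗≫ σ₂.hom ▷ F₂.w =
      𝟙 ((z' ≫ r'.v₁) ≫ F₁.w) ⊗≫ z' ◁ r'.α.hom ⊗≫ 𝟙 ((z' ≫ r'.v₂) ≫ F₂.w) ∧
    σ₁.hom ▷ F₁.f ⊗≫ z ◁ r.β ⊗≫ σ₂.hom ▷ F₂.f =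
      𝟙 ((z' ≫ r'.v₁) ≫ F₁.f) ⊗≫ z' ◁ r'.β ⊗≫ 𝟙 ((z' ≫ r'.v₂) ≫ F₂.f)

/-- The 2-morphisms of the bicategory of fractions. -/
def Cell {W : MorphismProperty K} {A B : K} (F₁ F₂ : Frac W A B) :=
  Quot (Rep.Rel (F₁ := F₁) (F₂ := F₂))

/-- The 2-morphism represented by `r`. -/
def Rep.cell {W : MorphismProperty K} {A B : K} {F₁ F₂ : Frac W A B} (r : Rep F₁ F₂) :
    Cell F₁ F₂ :=
  Quot.mk _ r

variable {W : MorphismProperty K}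

namespace BF

theorem mem_of_iso (hW : BF W) {X Y : K} {f g : X ⟶ Y} (e : f ≅ g) (hg : W g) : W f :=
  hW.bf5 f g hg ⟨e⟩

end BF

/-- The second leg composite of a representative also lies in `W`. -/
theorem Rep.mem₂ (hW : BF W) {A B : K} {F₁ F₂ : Frac W A B} (r : Rep F₁ F₂) : W (r.v₂ ≫ F₂.w) :=
  hW.mem_of_iso r.α.symm r.mem

/-- The identity of `A`. -/
abbrev idFrac (hW : BF W) (A : K) : Frac W A A where
  pt := A
  w := 𝟙 A
  f := 𝟙 A
  w_mem := hW.bf1 A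

/-- The square chosen by `C(W)` for composing `F` and `G`. -/
abbrev CChoices.sq (C : CChoices W) {X Y Z : K} (F : Frac W X Y) (G : Frac W Y Z) :
    OreSquare W F.f G.w :=
  C.square F.f G.w G.w_mem

/-- The composite `G ∘ F`. -/
abbrev compFrac (hW : BF W) (C : CChoices W) {X Y Z : K} (F : Frac W X Y) (G : Frac W Y Z) :
    Frac W X Z where
  pt := (C.sq F G).pt
  w := (C.sq F G).fst ≫ F.w
  f := (C.sq F G).snd ≫ G.f
  w_mem := hW.bf2 _ _ (C.sq F G).fst_mem F.w_mem

/-- The representative of an identity 2-morphism. -/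
def idRep (hW : BF W) {A B : K} (F : Frac W A B) : Rep F F where
  pt := F.pt
  v₁ := 𝟙 F.pt
  v₂ := 𝟙 F.pt
  α := Iso.refl _
  β := 𝟙 _
  mem := hW.bf2 _ _ (hW.bf1 _) F.w_mem

/-- The representative of the unitor `F ∘ id ⇒ F`. -/
def leftUnitorRep (hW : BF W) (C : CChoices W) {A B : K} (F : Frac W A B) :
    Rep (compFrac hW C (idFrac hW A) F) F where
  pt := (C.sq (idFrac hW A) F).pt
  v₁ := 𝟙 _
  v₂ := (C.sq (idFrac hW A) F).snd
  α := λ_ ((C.sq (idFrac hW A) F).fst ≫ 𝟙 A) ≪≫ (C.sq (idFrac hW A) F).iso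
  β := (λ_ ((C.sq (idFrac hW A) F).snd ≫ F.f)).hom
  mem := hW.bf2 _ _ (hW.bf1 _) (compFrac hW C (idFrac hW A) F).w_mem

/-- The representative of the unitor `id ∘ F ⇒ F`. -/
def rightUnitorRep (hW : BF W) (C : CChoices W) {A B : K} (F : Frac W A B) :
    Rep (compFrac hW C F (idFrac hW B)) F where
  pt := (C.sq F (idFrac hW B)).pt
  v₁ := 𝟙 _
  v₂ := (C.sq F (idFrac hW B)).fst
  α := λ_ ((C.sq F (idFrac hW B)).fst ≫ F.w)
  β := (λ_ ((C.sq F (idFrac hW B)).snd ≫ 𝟙 B)).hom ≫ (C.sq F (idFrac hW B)).iso.inv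
  mem := hW.bf2 _ _ (hW.bf1 _) (compFrac hW C F (idFrac hW B)).w_mem

/-! ### Vertical composition -/

/-- Data from which a representative of a vertical composite can be formed. The membership
condition holds whenever `t₁` lies in `W`. -/
structure VertFilling {A B : K} {F₁ F₂ F₃ : Frac W A B} (r : Rep F₁ F₂) (s : Rep F₂ F₃) where
  pt : K
  t₁ : pt ⟶ r.pt
  t₂ : pt ⟶ s.pt
  ρ : t₁ ≫ r.v₂ ≅ t₂ ≫ s.v₁
  mem : W ((t₁ ≫ r.v₁) ≫ F₁.w)

/-- The representative of the vertical composite given by a filling. -/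
def VertFilling.rep {A B : K} {F₁ F₂ F₃ : Frac W A B} {r : Rep F₁ F₂} {s : Rep F₂ F₃}
    (X : VertFilling r s) : Rep F₁ F₃ where
  pt := X.pt
  v₁ := X.t₁ ≫ r.v₁
  v₂ := X.t₂ ≫ s.v₂
  α := Iso.refl ((X.t₁ ≫ r.v₁) ≫ F₁.w) ≪⊗≫ whiskerLeftIso X.t₁ r.α ≪⊗≫
    whiskerRightIso X.ρ F₂.w ≪⊗≫ whiskerLeftIso X.t₂ s.α ≪⊗≫
    Iso.refl ((X.t₂ ≫ s.v₂) ≫ F₃.w)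
  β := 𝟙 ((X.t₁ ≫ r.v₁) ≫ F₁.f) ⊗≫ X.t₁ ◁ r.β ⊗≫ X.ρ.hom ▷ F₂.f ⊗≫ X.t₂ ◁ s.β ⊗≫
    𝟙 ((X.t₂ ≫ s.v₂) ≫ F₃.f)
  mem := X.mem

/-- The 2-morphism of a square over `(w² ∘ r.v₂, w² ∘ s.v₁)`, rebracketed. -/
def vertPasting {A B : K} {F₁ F₂ F₃ : Frac W A B} {r : Rep F₁ F₂} {s : Rep F₂ F₃}
    (q : OreSquare W (r.v₂ ≫ F₂.w) (s.v₁ ≫ F₂.w)) :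
    (q.fst ≫ r.v₂) ≫ F₂.w ≅ (q.snd ≫ s.v₁) ≫ F₂.w :=
  Iso.refl ((q.fst ≫ r.v₂) ≫ F₂.w) ≪⊗≫ q.iso ≪⊗≫ Iso.refl ((q.snd ≫ s.v₁) ≫ F₂.w)

/-- The filling given by such a square and a lift of its 2-morphism along `w²`. -/
noncomputable def VertFilling.ofLift (hW : BF W) {A B : K} {F₁ F₂ F₃ : Frac W A B}
    {r : Rep F₁ F₂} {s : Rep F₂ F₃} (q : OreSquare W (r.v₂ ≫ F₂.w) (s.v₁ ≫ F₂.w))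
    (L : CellLift W F₂.w (q.fst ≫ r.v₂) (q.snd ≫ s.v₁) (vertPasting q).hom) (hL : IsIso L.β) :
    VertFilling r s where
  pt := L.pt
  t₁ := L.v ≫ q.fst
  t₂ := L.v ≫ q.snd
  ρ := Iso.refl ((L.v ≫ q.fst) ≫ r.v₂) ≪⊗≫ L.isoβ hL ≪⊗≫ Iso.refl ((L.v ≫ q.snd) ≫ s.v₁)
  mem := hW.mem_of_iso (α_ _ _ _) (hW.bf2 _ _ (hW.bf2 _ _ L.v_mem q.fst_mem) r.mem)

/-- The filling determined by `C(W)` and `D(W)`: the square chosen for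
`(w² ∘ r.v₂, w² ∘ s.v₁)`, then the chosen lift of its 2-morphism along `w²`. -/
noncomputable def vertFilling (hW : BF W) (C : CChoices W) (D : DChoices W) {A B : K}
    {F₁ F₂ F₃ : Frac W A B} (r : Rep F₁ F₂) (s : Rep F₂ F₃) : VertFilling r s :=
  VertFilling.ofLift hW (C.square (r.v₂ ≫ F₂.w) (s.v₁ ≫ F₂.w) s.mem)
    (D.lift F₂.w F₂.w_mem _ _ _) (D.isIso_lift F₂.w F₂.w_mem _ _ _ inferInstance)

/-! ### Associators -/

/-- The square chosen by `C(W)` for composing `G ∘ F` with `H`. -/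
abbrev CChoices.sqL (C : CChoices W) {X Y Z T : K} (F : Frac W X Y) (G : Frac W Y Z)
    (H : Frac W Z T) : OreSquare W ((C.sq F G).snd ≫ G.f) H.w :=
  C.square ((C.sq F G).snd ≫ G.f) H.w H.w_mem

/-- The square chosen by `C(W)` for composing `F` with `H ∘ G`. -/
abbrev CChoices.sqR (C : CChoices W) (hW : BF W) {X Y Z T : K} (F : Frac W X Y) (G : Frac W Y Z)
    (H : Frac W Z T) : OreSquare W F.f ((C.sq G H).fst ≫ G.w) :=
  C.square F.f ((C.sq G H).fst ≫ G.w) (hW.bf2 _ _ (C.sq G H).fst_mem G.w_mem)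

/-- Data from which a representative of the associator `H ∘ (G ∘ F) ⇒ (H ∘ G) ∘ F` can be
formed. -/
structure AssocFilling (hW : BF W) (C : CChoices W) {X Y Z T : K} (F : Frac W X Y)
    (G : Frac W Y Z) (H : Frac W Z T) where
  pt : K
  u₄ : pt ⟶ (C.sqL F G H).pt
  u₅ : pt ⟶ (C.sqR hW F G H).pt
  γ : u₄ ≫ (C.sqL F G H).fst ≫ (C.sq F G).fst ≅ u₅ ≫ (C.sqR hW F G H).fst
  ω : u₄ ≫ (C.sqL F G H).fst ≫ (C.sq F G).snd ≅
    u₅ ≫ (C.sqR hW F G H).snd ≫ (C.sq G H).fst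
  ρ : u₄ ≫ (C.sqL F G H).snd ≅ u₅ ≫ (C.sqR hW F G H).snd ≫ (C.sq G H).snd
  mem : W (u₄ ≫ (C.sqL F G H).fst ≫ (C.sq F G).fst ≫ F.w)

/-- The two compatibility conditions on the data: `v ∘ ω` is the pasting of `δ⁻¹`, `γ`, `η`, and
`w ∘ ρ` is the pasting of `σ⁻¹`, `ω`, `ξ`, where `δ`, `σ`, `ξ`, `η` are the chosen squares. -/
structure AssocFilling.Valid {hW : BF W} {C : CChoices W} {X Y Z T : K} {F : Frac W X Y}
    {G : Frac W Y Z} {H : Frac W Z T} (P : AssocFilling hW C F G H) : Prop where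
  ω_eq : P.ω.hom ▷ G.w =
    𝟙 ((P.u₄ ≫ (C.sqL F G H).fst ≫ (C.sq F G).snd) ≫ G.w) ⊗≫
      (P.u₄ ≫ (C.sqL F G H).fst) ◁ (C.sq F G).iso.inv ⊗≫
      P.γ.hom ▷ F.f ⊗≫
      P.u₅ ◁ (C.sqR hW F G H).iso.hom ⊗≫
      𝟙 ((P.u₅ ≫ (C.sqR hW F G H).snd ≫ (C.sq G H).fst) ≫ G.w)
  ρ_eq : P.ρ.hom ▷ H.w =
    𝟙 ((P.u₄ ≫ (C.sqL F G H).snd) ≫ H.w) ⊗≫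
      P.u₄ ◁ (C.sqL F G H).iso.inv ⊗≫
      P.ω.hom ▷ G.f ⊗≫
      (P.u₅ ≫ (C.sqR hW F G H).snd) ◁ (C.sq G H).iso.hom ⊗≫
      𝟙 ((P.u₅ ≫ (C.sqR hW F G H).snd ≫ (C.sq G H).snd) ≫ H.w)

/-- The representative of the associator given by a filling. -/
def AssocFilling.rep {hW : BF W} {C : CChoices W} {X Y Z T : K} {F : Frac W X Y}
    {G : Frac W Y Z} {H : Frac W Z T} (P : AssocFilling hW C F G H) :
    Rep (compFrac hW C (compFrac hW C F G) H) (compFrac hW C F (compFrac hW C G H)) where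
  pt := P.pt
  v₁ := P.u₄
  v₂ := P.u₅
  α := Iso.refl (P.u₄ ≫ (C.sqL F G H).fst ≫ (C.sq F G).fst ≫ F.w) ≪⊗≫
    whiskerRightIso P.γ F.w ≪⊗≫ Iso.refl (P.u₅ ≫ (C.sqR hW F G H).fst ≫ F.w)
  β := 𝟙 (P.u₄ ≫ (C.sqL F G H).snd ≫ H.f) ⊗≫ P.ρ.hom ▷ H.f ⊗≫
    𝟙 (P.u₅ ≫ (C.sqR hW F G H).snd ≫ (C.sq G H).snd ≫ H.f)
  mem := P.mem

/-- The pasting of `δ⁻¹`, of a square `q` over `(u¹ ∘ u², u³)` and of `η`. -/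
def assocPasting₁ {hW : BF W} {C : CChoices W} {X Y Z T : K} {F : Frac W X Y} {G : Frac W Y Z}
    {H : Frac W Z T}
    (q : OreSquare W ((C.sqL F G H).fst ≫ (C.sq F G).fst) (C.sqR hW F G H).fst) :
    (q.fst ≫ (C.sqL F G H).fst ≫ (C.sq F G).snd) ≫ G.w ≅
      (q.snd ≫ (C.sqR hW F G H).snd ≫ (C.sq G H).fst) ≫ G.w :=
  Iso.refl ((q.fst ≫ (C.sqL F G H).fst ≫ (C.sq F G).snd) ≫ G.w) ≪⊗≫
    whiskerLeftIso (q.fst ≫ (C.sqL F G H).fst) (C.sq F G).iso.symm ≪⊗≫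
    whiskerRightIso q.iso F.f ≪⊗≫
    whiskerLeftIso q.snd (C.sqR hW F G H).iso ≪⊗≫
    Iso.refl ((q.snd ≫ (C.sqR hW F G H).snd ≫ (C.sq G H).fst) ≫ G.w)

/-- The pasting of `σ⁻¹`, of an isomorphism `ω` and of `ξ`. -/
def assocPasting₂ {hW : BF W} {C : CChoices W} {X Y Z T : K} {F : Frac W X Y} {G : Frac W Y Z}
    {H : Frac W Z T}
    (q : OreSquare W ((C.sqL F G H).fst ≫ (C.sq F G).fst) (C.sqR hW F G H).fst)
    {E : K} (z : E ⟶ q.pt)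
    (ω : z ≫ q.fst ≫ (C.sqL F G H).fst ≫ (C.sq F G).snd ≅
      z ≫ q.snd ≫ (C.sqR hW F G H).snd ≫ (C.sq G H).fst) :
    (z ≫ q.fst ≫ (C.sqL F G H).snd) ≫ H.w ≅
      (z ≫ q.snd ≫ (C.sqR hW F G H).snd ≫ (C.sq G H).snd) ≫ H.w :=
  Iso.refl ((z ≫ q.fst ≫ (C.sqL F G H).snd) ≫ H.w) ≪⊗≫
    whiskerLeftIso (z ≫ q.fst) (C.sqL F G H).iso.symm ≪⊗≫
    whiskerRightIso ω G.f ≪⊗≫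
    whiskerLeftIso (z ≫ q.snd ≫ (C.sqR hW F G H).snd) (C.sq G H).iso ≪⊗≫
    Iso.refl ((z ≫ q.snd ≫ (C.sqR hW F G H).snd ≫ (C.sq G H).snd) ≫ H.w)

/-- The filling given by a square `q` over `(u¹ ∘ u², u³)`, a lift of the first pasting along `v`
and a lift of the resulting second pasting along `w`. -/
noncomputable def AssocFilling.ofLifts {hW : BF W} {C : CChoices W} {X Y Z T : K}
    {F : Frac W X Y} {G : Frac W Y Z} {H : Frac W Z T}
    (q : OreSquare W ((C.sqL F G H).fst ≫ (C.sq F G).fst) (C.sqR hW F G H).fst)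
    (L : CellLift W G.w (q.fst ≫ (C.sqL F G H).fst ≫ (C.sq F G).snd)
      (q.snd ≫ (C.sqR hW F G H).snd ≫ (C.sq G H).fst) (assocPasting₁ q).hom)
    (hL : IsIso L.β)
    (M : CellLift W H.w (L.v ≫ q.fst ≫ (C.sqL F G H).snd)
      (L.v ≫ q.snd ≫ (C.sqR hW F G H).snd ≫ (C.sq G H).snd)
      (assocPasting₂ q L.v (L.isoβ hL)).hom)
    (hM : IsIso M.β) : AssocFilling hW C F G H where
  pt := M.pt
  u₄ := M.v ≫ L.v ≫ q.fst
  u₅ := M.v ≫ L.v ≫ q.snd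
  γ := Iso.refl ((M.v ≫ L.v ≫ q.fst) ≫ (C.sqL F G H).fst ≫ (C.sq F G).fst) ≪⊗≫
    whiskerLeftIso (M.v ≫ L.v) q.iso ≪⊗≫
    Iso.refl ((M.v ≫ L.v ≫ q.snd) ≫ (C.sqR hW F G H).fst)
  ω := Iso.refl ((M.v ≫ L.v ≫ q.fst) ≫ (C.sqL F G H).fst ≫ (C.sq F G).snd) ≪⊗≫
    whiskerLeftIso M.v (L.isoβ hL) ≪⊗≫
    Iso.refl ((M.v ≫ L.v ≫ q.snd) ≫ (C.sqR hW F G H).snd ≫ (C.sq G H).fst)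
  ρ := Iso.refl ((M.v ≫ L.v ≫ q.fst) ≫ (C.sqL F G H).snd) ≪⊗≫ M.isoβ hM ≪⊗≫
    Iso.refl ((M.v ≫ L.v ≫ q.snd) ≫ (C.sqR hW F G H).snd ≫ (C.sq G H).snd)
  mem := hW.bf2 _ _ (hW.bf2 _ _ M.v_mem (hW.bf2 _ _ L.v_mem q.fst_mem))
    (hW.bf2 _ _ (C.sqL F G H).fst_mem (hW.bf2 _ _ (C.sq F G).fst_mem F.w_mem))

/-- The filling determined by `C(W)` and `D(W)`: the square chosen for `(u¹ ∘ u², u³)` and the two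
chosen lifts. -/
noncomputable def assocFilling (hW : BF W) (C : CChoices W) (D : DChoices W) {X Y Z T : K}
    (F : Frac W X Y) (G : Frac W Y Z) (H : Frac W Z T) : AssocFilling hW C F G H :=
  AssocFilling.ofLifts
    (C.square ((C.sqL F G H).fst ≫ (C.sq F G).fst) (C.sqR hW F G H).fst
      (C.sqR hW F G H).fst_mem)
    (D.lift G.w G.w_mem _ _ _) (D.isIso_lift G.w G.w_mem _ _ _ inferInstance)
    (D.lift H.w H.w_mem _ _ _) (D.isIso_lift H.w H.w_mem _ _ _ inferInstance)

/-! ### Whiskering `Δ ∘ F` of a 2-morphism with a morphism that is composed first -/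

/-- Data from which a representative of `Δ ∘ F` can be formed, where `r` represents `Δ`. The
membership condition holds whenever `t₁` and `t₃` lie in `W`. -/
structure LeftFilling (C : CChoices W) {X Y Z : K} (F : Frac W X Y) {G₁ G₂ : Frac W Y Z}
    (r : Rep G₁ G₂) where
  D₃ : K
  t₁ : D₃ ⟶ (C.sq F G₁).pt
  h₁ : D₃ ⟶ r.pt
  σ₁ : t₁ ≫ (C.sq F G₁).snd ≅ h₁ ≫ r.v₁
  D₄ : K
  t₂ : D₄ ⟶ (C.sq F G₂).pt
  h₂ : D₄ ⟶ r.pt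
  σ₂ : t₂ ≫ (C.sq F G₂).snd ≅ h₂ ≫ r.v₂
  D₅ : K
  t₃ : D₅ ⟶ D₃
  t₄ : D₅ ⟶ D₄
  φ : t₃ ≫ t₁ ≫ (C.sq F G₁).fst ≅ t₄ ≫ t₂ ≫ (C.sq F G₂).fst
  δ : t₃ ≫ h₁ ≅ t₄ ≫ h₂
  mem : W ((t₃ ≫ t₁) ≫ (C.sq F G₁).fst ≫ F.w)

/-- The 2-morphism `δ` lifts the pasting of the other data along `v¹ ∘ u¹`. -/
def LeftFilling.Valid {C : CChoices W} {X Y Z : K} {F : Frac W X Y} {G₁ G₂ : Frac W Y Z}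
    {r : Rep G₁ G₂} (P : LeftFilling C F r) : Prop :=
  P.δ.hom ▷ (r.v₁ ≫ G₁.w) =
    𝟙 ((P.t₃ ≫ P.h₁) ≫ r.v₁ ≫ G₁.w) ⊗≫
      P.t₃ ◁ P.σ₁.inv ▷ G₁.w ⊗≫
      (P.t₃ ≫ P.t₁) ◁ (C.sq F G₁).iso.inv ⊗≫
      P.φ.hom ▷ F.f ⊗≫
      (P.t₄ ≫ P.t₂) ◁ (C.sq F G₂).iso.hom ⊗≫
      P.t₄ ◁ P.σ₂.hom ▷ G₂.w ⊗≫
      (P.t₄ ≫ P.h₂) ◁ r.α.inv ⊗≫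
      𝟙 ((P.t₄ ≫ P.h₂) ≫ r.v₁ ≫ G₁.w)

/-- The representative of `Δ ∘ F` given by a filling. -/
def LeftFilling.rep (hW : BF W) {C : CChoices W} {X Y Z : K} {F : Frac W X Y}
    {G₁ G₂ : Frac W Y Z} {r : Rep G₁ G₂} (P : LeftFilling C F r) :
    Rep (compFrac hW C F G₁) (compFrac hW C F G₂) where
  pt := P.D₅
  v₁ := P.t₃ ≫ P.t₁
  v₂ := P.t₄ ≫ P.t₂
  α := Iso.refl ((P.t₃ ≫ P.t₁) ≫ (C.sq F G₁).fst ≫ F.w) ≪⊗≫ whiskerRightIso P.φ F.w ≪⊗≫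
    Iso.refl ((P.t₄ ≫ P.t₂) ≫ (C.sq F G₂).fst ≫ F.w)
  β := 𝟙 ((P.t₃ ≫ P.t₁) ≫ (C.sq F G₁).snd ≫ G₁.f) ⊗≫
    P.t₃ ◁ P.σ₁.hom ▷ G₁.f ⊗≫
    P.δ.hom ▷ (r.v₁ ≫ G₁.f) ⊗≫
    (P.t₄ ≫ P.h₂) ◁ r.β ⊗≫
    P.t₄ ◁ P.σ₂.inv ▷ G₂.f ⊗≫
    𝟙 ((P.t₄ ≫ P.t₂) ≫ (C.sq F G₂).snd ≫ G₂.f)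
  mem := P.mem

/-- One half of the construction of `Δ ∘ F` from `C(W)` and `D(W)`: for `F`, `G` and a morphism
`x` with `G.w ∘ x` in `W`, a morphism `t` into the chosen composite, a morphism `h` and an
invertible `σ : f' ∘ t ⇒ x ∘ h`. -/
structure HalfFilling (C : CChoices W) {X Y Z : K} (F : Frac W X Y) (G : Frac W Y Z) {P : K}
    (x : P ⟶ G.pt) where
  pt : K
  t : pt ⟶ (C.sq F G).pt
  h : pt ⟶ P
  σ : t ≫ (C.sq F G).snd ≅ h ≫ x
  mem : W (t ≫ (C.sq F G).fst)

/-- The pasting of `ρ⁻¹`, `l⁻¹` and `τ`, where `ρ` is the square chosen for composing `F` and `G`,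
`τ` is a square over `(f, v ∘ x)` and `l` is a square over their legs into the source of `f`. -/
def halfPasting {C : CChoices W} {X Y Z : K} {F : Frac W X Y} {G : Frac W Y Z} {P : K}
    {x : P ⟶ G.pt} (τ : OreSquare W F.f (x ≫ G.w)) (l : OreSquare W τ.fst (C.sq F G).fst) :
    (l.snd ≫ (C.sq F G).snd) ≫ G.w ≅ (l.fst ≫ τ.snd ≫ x) ≫ G.w :=
  Iso.refl ((l.snd ≫ (C.sq F G).snd) ≫ G.w) ≪⊗≫
    whiskerLeftIso l.snd (C.sq F G).iso.symm ≪⊗≫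
    whiskerRightIso l.iso.symm F.f ≪⊗≫
    whiskerLeftIso l.fst τ.iso ≪⊗≫
    Iso.refl ((l.fst ≫ τ.snd ≫ x) ≫ G.w)

/-- The half filling given by such squares and a lift of their pasting along `v`. -/
noncomputable def HalfFilling.ofLift (hW : BF W) {C : CChoices W} {X Y Z : K} {F : Frac W X Y}
    {G : Frac W Y Z} {P : K} {x : P ⟶ G.pt} (τ : OreSquare W F.f (x ≫ G.w))
    (l : OreSquare W τ.fst (C.sq F G).fst)
    (L : CellLift W G.w (l.snd ≫ (C.sq F G).snd) (l.fst ≫ τ.snd ≫ x) (halfPasting τ l).hom)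
    (hL : IsIso L.β) : HalfFilling C F G x where
  pt := L.pt
  t := L.v ≫ l.snd
  h := L.v ≫ l.fst ≫ τ.snd
  σ := Iso.refl ((L.v ≫ l.snd) ≫ (C.sq F G).snd) ≪⊗≫ L.isoβ hL ≪⊗≫
    Iso.refl ((L.v ≫ l.fst ≫ τ.snd) ≫ x)
  mem := hW.mem_of_iso (α_ _ _ _ ≪≫ whiskerLeftIso L.v l.iso.symm)
    (hW.bf2 _ _ L.v_mem (hW.bf2 _ _ l.fst_mem τ.fst_mem))

/-- The half filling determined by `C(W)` and `D(W)`. -/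
noncomputable def halfFilling (hW : BF W) (C : CChoices W) (D : DChoices W) {X Y Z : K}
    (F : Frac W X Y) (G : Frac W Y Z) {P : K} (x : P ⟶ G.pt) (hx : W (x ≫ G.w)) :
    HalfFilling C F G x :=
  HalfFilling.ofLift hW (C.square F.f (x ≫ G.w) hx)
    (C.square (C.square F.f (x ≫ G.w) hx).fst (C.sq F G).fst (C.sq F G).fst_mem)
    (D.lift G.w G.w_mem _ _ _) (D.isIso_lift G.w G.w_mem _ _ _ inferInstance)

/-- The pasting that `δ` has to lift, for a square `q` over the legs of two half fillings. -/
def leftPasting {C : CChoices W} {X Y Z : K} {F : Frac W X Y} {G₁ G₂ : Frac W Y Z}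
    {r : Rep G₁ G₂} (m : HalfFilling C F G₁ r.v₁) (n : HalfFilling C F G₂ r.v₂)
    (q : OreSquare W (m.t ≫ (C.sq F G₁).fst) (n.t ≫ (C.sq F G₂).fst)) :
    (q.fst ≫ m.h) ≫ r.v₁ ≫ G₁.w ≅ (q.snd ≫ n.h) ≫ r.v₁ ≫ G₁.w :=
  Iso.refl ((q.fst ≫ m.h) ≫ r.v₁ ≫ G₁.w) ≪⊗≫
    whiskerLeftIso q.fst (whiskerRightIso m.σ.symm G₁.w) ≪⊗≫
    whiskerLeftIso (q.fst ≫ m.t) (C.sq F G₁).iso.symm ≪⊗≫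
    whiskerRightIso q.iso F.f ≪⊗≫
    whiskerLeftIso (q.snd ≫ n.t) (C.sq F G₂).iso ≪⊗≫
    whiskerLeftIso q.snd (whiskerRightIso n.σ G₂.w) ≪⊗≫
    whiskerLeftIso (q.snd ≫ n.h) r.α.symm ≪⊗≫
    Iso.refl ((q.snd ≫ n.h) ≫ r.v₁ ≫ G₁.w)

/-- The filling for `Δ ∘ F` given by two half fillings, a square over their legs and a lift of
the resulting pasting along `v¹ ∘ u¹`. -/
noncomputable def LeftFilling.ofLift (hW : BF W) {C : CChoices W} {X Y Z : K} {F : Frac W X Y}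
    {G₁ G₂ : Frac W Y Z} {r : Rep G₁ G₂} (m : HalfFilling C F G₁ r.v₁)
    (n : HalfFilling C F G₂ r.v₂)
    (q : OreSquare W (m.t ≫ (C.sq F G₁).fst) (n.t ≫ (C.sq F G₂).fst))
    (L : CellLift W (r.v₁ ≫ G₁.w) (q.fst ≫ m.h) (q.snd ≫ n.h) (leftPasting m n q).hom)
    (hL : IsIso L.β) : LeftFilling C F r where
  D₃ := m.pt
  t₁ := m.t
  h₁ := m.h
  σ₁ := m.σ
  D₄ := n.pt
  t₂ := n.t
  h₂ := n.h
  σ₂ := n.σ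
  D₅ := L.pt
  t₃ := L.v ≫ q.fst
  t₄ := L.v ≫ q.snd
  φ := Iso.refl ((L.v ≫ q.fst) ≫ m.t ≫ (C.sq F G₁).fst) ≪⊗≫ whiskerLeftIso L.v q.iso ≪⊗≫
    Iso.refl ((L.v ≫ q.snd) ≫ n.t ≫ (C.sq F G₂).fst)
  δ := Iso.refl ((L.v ≫ q.fst) ≫ m.h) ≪⊗≫ L.isoβ hL ≪⊗≫ Iso.refl ((L.v ≫ q.snd) ≫ n.h)
  mem := hW.mem_of_iso
    (Iso.refl (((L.v ≫ q.fst) ≫ m.t) ≫ (C.sq F G₁).fst ≫ F.w) ≪⊗≫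
      Iso.refl ((L.v ≫ q.fst) ≫ (m.t ≫ (C.sq F G₁).fst) ≫ F.w))
    (hW.bf2 _ _ (hW.bf2 _ _ L.v_mem q.fst_mem) (hW.bf2 _ _ m.mem F.w_mem))

/-- The filling for `Δ ∘ F` determined by `C(W)` and `D(W)`. -/
noncomputable def leftFilling (hW : BF W) (C : CChoices W) (D : DChoices W) {X Y Z : K}
    (F : Frac W X Y) {G₁ G₂ : Frac W Y Z} (r : Rep G₁ G₂) : LeftFilling C F r :=
  LeftFilling.ofLift hW (halfFilling hW C D F G₁ r.v₁ r.mem)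
    (halfFilling hW C D F G₂ r.v₂ (r.mem₂ hW))
    (C.square _ _ (halfFilling hW C D F G₂ r.v₂ (r.mem₂ hW)).mem)
    (D.lift (r.v₁ ≫ G₁.w) r.mem _ _ _)
    (D.isIso_lift (r.v₁ ≫ G₁.w) r.mem _ _ _ inferInstance)

/-! ### Whiskering `G ∘ Γ` of a 2-morphism with a morphism that is composed last -/

/-- Data from which a representative of `G ∘ Γ` can be formed, where `r` represents `Γ`. The
membership condition holds whenever `u₃` and `u₇` lie in `W`. -/
structure RightFilling (C : CChoices W) {X Y Z : K} {F₁ F₂ : Frac W X Y} (r : Rep F₁ F₂)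
    (G : Frac W Y Z) where
  D₃ : K
  u₃ : D₃ ⟶ r.pt
  u₄ : D₃ ⟶ (C.sq F₁ G).pt
  η₁ : u₃ ≫ r.v₁ ≅ u₄ ≫ (C.sq F₁ G).fst
  D₄ : K
  u₅ : D₄ ⟶ r.pt
  u₆ : D₄ ⟶ (C.sq F₂ G).pt
  η₂ : u₅ ≫ r.v₂ ≅ u₆ ≫ (C.sq F₂ G).fst
  D₅ : K
  u₇ : D₅ ⟶ D₃
  u₈ : D₅ ⟶ D₄
  η₃ : u₇ ≫ u₃ ≅ u₈ ≫ u₅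
  lam : u₇ ≫ u₄ ≫ (C.sq F₁ G).snd ⟶ u₈ ≫ u₆ ≫ (C.sq F₂ G).snd
  mem : W ((u₇ ≫ u₄) ≫ (C.sq F₁ G).fst ≫ F₁.w)

/-- The 2-morphism `lam` lifts the pasting of the other data along `u`. -/
def RightFilling.Valid {C : CChoices W} {X Y Z : K} {F₁ F₂ : Frac W X Y} {r : Rep F₁ F₂}
    {G : Frac W Y Z} (P : RightFilling C r G) : Prop :=
  P.lam ▷ G.w =
    𝟙 ((P.u₇ ≫ P.u₄ ≫ (C.sq F₁ G).snd) ≫ G.w) ⊗≫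
      (P.u₇ ≫ P.u₄) ◁ (C.sq F₁ G).iso.inv ⊗≫
      P.u₇ ◁ P.η₁.inv ▷ F₁.f ⊗≫
      P.η₃.hom ▷ (r.v₁ ≫ F₁.f) ⊗≫
      (P.u₈ ≫ P.u₅) ◁ r.β ⊗≫
      P.u₈ ◁ P.η₂.hom ▷ F₂.f ⊗≫
      (P.u₈ ≫ P.u₆) ◁ (C.sq F₂ G).iso.hom ⊗≫
      𝟙 ((P.u₈ ≫ P.u₆ ≫ (C.sq F₂ G).snd) ≫ G.w)

/-- The representative of `G ∘ Γ` given by a filling. -/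
def RightFilling.rep (hW : BF W) {C : CChoices W} {X Y Z : K} {F₁ F₂ : Frac W X Y}
    {r : Rep F₁ F₂} {G : Frac W Y Z} (P : RightFilling C r G) :
    Rep (compFrac hW C F₁ G) (compFrac hW C F₂ G) where
  pt := P.D₅
  v₁ := P.u₇ ≫ P.u₄
  v₂ := P.u₈ ≫ P.u₆
  α := Iso.refl ((P.u₇ ≫ P.u₄) ≫ (C.sq F₁ G).fst ≫ F₁.w) ≪⊗≫
    whiskerLeftIso P.u₇ (whiskerRightIso P.η₁.symm F₁.w) ≪⊗≫
    whiskerRightIso P.η₃ (r.v₁ ≫ F₁.w) ≪⊗≫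
    whiskerLeftIso (P.u₈ ≫ P.u₅) r.α ≪⊗≫
    whiskerLeftIso P.u₈ (whiskerRightIso P.η₂ F₂.w) ≪⊗≫
    Iso.refl ((P.u₈ ≫ P.u₆) ≫ (C.sq F₂ G).fst ≫ F₂.w)
  β := 𝟙 ((P.u₇ ≫ P.u₄) ≫ (C.sq F₁ G).snd ≫ G.f) ⊗≫ P.lam ▷ G.f ⊗≫
    𝟙 ((P.u₈ ≫ P.u₆) ≫ (C.sq F₂ G).snd ≫ G.f)
  mem := P.mem

/-- The pasting that `lam` has to lift, for squares `x₁` over `(v¹, u¹)`, `x₂` over `(v², u²)` and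
`x₃` over their legs into `A³`. -/
def rightPasting {C : CChoices W} {X Y Z : K} {F₁ F₂ : Frac W X Y} {r : Rep F₁ F₂}
    {G : Frac W Y Z} (x₁ : OreSquare W r.v₁ (C.sq F₁ G).fst)
    (x₂ : OreSquare W r.v₂ (C.sq F₂ G).fst) (x₃ : OreSquare W x₁.fst x₂.fst) :
    (x₃.fst ≫ x₁.snd ≫ (C.sq F₁ G).snd) ≫ G.w ⟶
      (x₃.snd ≫ x₂.snd ≫ (C.sq F₂ G).snd) ≫ G.w :=
  𝟙 ((x₃.fst ≫ x₁.snd ≫ (C.sq F₁ G).snd) ≫ G.w) ⊗≫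
    (x₃.fst ≫ x₁.snd) ◁ (C.sq F₁ G).iso.inv ⊗≫
    x₃.fst ◁ x₁.iso.inv ▷ F₁.f ⊗≫
    x₃.iso.hom ▷ (r.v₁ ≫ F₁.f) ⊗≫
    (x₃.snd ≫ x₂.fst) ◁ r.β ⊗≫
    x₃.snd ◁ x₂.iso.hom ▷ F₂.f ⊗≫
    (x₃.snd ≫ x₂.snd) ◁ (C.sq F₂ G).iso.hom ⊗≫
    𝟙 ((x₃.snd ≫ x₂.snd ≫ (C.sq F₂ G).snd) ≫ G.w)

/-- The filling for `G ∘ Γ` given by such squares and a lift of their pasting along `u`. -/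
def RightFilling.ofLift (hW : BF W) {C : CChoices W} {X Y Z : K} {F₁ F₂ : Frac W X Y}
    {r : Rep F₁ F₂} {G : Frac W Y Z} (x₁ : OreSquare W r.v₁ (C.sq F₁ G).fst)
    (x₂ : OreSquare W r.v₂ (C.sq F₂ G).fst) (x₃ : OreSquare W x₁.fst x₂.fst)
    (L : CellLift W G.w (x₃.fst ≫ x₁.snd ≫ (C.sq F₁ G).snd)
      (x₃.snd ≫ x₂.snd ≫ (C.sq F₂ G).snd) (rightPasting x₁ x₂ x₃)) : RightFilling C r G where
  D₃ := x₁.pt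
  u₃ := x₁.fst
  u₄ := x₁.snd
  η₁ := x₁.iso
  D₄ := x₂.pt
  u₅ := x₂.fst
  u₆ := x₂.snd
  η₂ := x₂.iso
  D₅ := L.pt
  u₇ := L.v ≫ x₃.fst
  u₈ := L.v ≫ x₃.snd
  η₃ := Iso.refl ((L.v ≫ x₃.fst) ≫ x₁.fst) ≪⊗≫ whiskerLeftIso L.v x₃.iso ≪⊗≫
    Iso.refl ((L.v ≫ x₃.snd) ≫ x₂.fst)
  lam := 𝟙 ((L.v ≫ x₃.fst) ≫ x₁.snd ≫ (C.sq F₁ G).snd) ⊗≫ L.β ⊗≫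
    𝟙 ((L.v ≫ x₃.snd) ≫ x₂.snd ≫ (C.sq F₂ G).snd)
  mem := hW.mem_of_iso
    (Iso.refl (((L.v ≫ x₃.fst) ≫ x₁.snd) ≫ (C.sq F₁ G).fst ≫ F₁.w) ≪⊗≫
      whiskerLeftIso (L.v ≫ x₃.fst) (whiskerRightIso x₁.iso.symm F₁.w) ≪⊗≫
      Iso.refl ((L.v ≫ x₃.fst) ≫ x₁.fst ≫ r.v₁ ≫ F₁.w))
    (hW.bf2 _ _ (hW.bf2 _ _ L.v_mem x₃.fst_mem) (hW.bf2 _ _ x₁.fst_mem r.mem))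

/-- The filling for `G ∘ Γ` determined by `C(W)` and `D(W)`. -/
def rightFilling (hW : BF W) (C : CChoices W) (D : DChoices W) {X Y Z : K}
    {F₁ F₂ : Frac W X Y} (r : Rep F₁ F₂) (G : Frac W Y Z) : RightFilling C r G :=
  RightFilling.ofLift hW (C.square r.v₁ (C.sq F₁ G).fst (C.sq F₁ G).fst_mem)
    (C.square r.v₂ (C.sq F₂ G).fst (C.sq F₂ G).fst_mem)
    (C.square _ _ (C.square r.v₂ (C.sq F₂ G).fst (C.sq F₂ G).fst_mem).fst_mem)
    (D.lift G.w G.w_mem _ _ _)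

/-! ### The bicategory of fractions -/

/-- The structure of a bicategory on the objects of `K`, the morphisms `Frac W`, the 2-morphisms
`Cell`, the identities `idFrac` and the composition `compFrac` of morphisms given by `C(W)`: the
remaining operations. Two bicategories of this kind are the same when these operations are. -/
@[ext]
structure Ops (hW : BF W) (C : CChoices W) where
  id₂ : ∀ {X Y : K} (F : Frac W X Y), Cell F F
  vcomp : ∀ {X Y : K} {F₁ F₂ F₃ : Frac W X Y}, Cell F₁ F₂ → Cell F₂ F₃ → Cell F₁ F₃
  whiskerLeft : ∀ {X Y Z : K} (F : Frac W X Y) {G₁ G₂ : Frac W Y Z}, Cell G₁ G₂ →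
    Cell (compFrac hW C F G₁) (compFrac hW C F G₂)
  whiskerRight : ∀ {X Y Z : K} {F₁ F₂ : Frac W X Y}, Cell F₁ F₂ → ∀ G : Frac W Y Z,
    Cell (compFrac hW C F₁ G) (compFrac hW C F₂ G)
  hcomp : ∀ {X Y Z : K} {F₁ F₂ : Frac W X Y} {G₁ G₂ : Frac W Y Z}, Cell F₁ F₂ → Cell G₁ G₂ →
    Cell (compFrac hW C F₁ G₁) (compFrac hW C F₂ G₂)
  associator : ∀ {X Y Z T : K} (F : Frac W X Y) (G : Frac W Y Z) (H : Frac W Z T),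
    Cell (compFrac hW C (compFrac hW C F G) H) (compFrac hW C F (compFrac hW C G H))
  leftUnitor : ∀ {X Y : K} (F : Frac W X Y), Cell (compFrac hW C (idFrac hW X) F) F
  rightUnitor : ∀ {X Y : K} (F : Frac W X Y), Cell (compFrac hW C F (idFrac hW Y)) F

/-- `S` is the structure of the bicategory of fractions constructed with the choices `C(W)` and
`D(W)`; each operation on 2-morphisms is computed on arbitrary representatives. -/
structure Ops.IsConstructed {hW : BF W} {C : CChoices W} (S : Ops hW C) (D : DChoices W) :
    Prop where
  id₂_eq : ∀ {X Y : K} (F : Frac W X Y), S.id₂ F = (idRep hW F).cell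
  vcomp_eq : ∀ {X Y : K} {F₁ F₂ F₃ : Frac W X Y} (r : Rep F₁ F₂) (s : Rep F₂ F₃),
    S.vcomp r.cell s.cell = (vertFilling hW C D r s).rep.cell
  whiskerLeft_eq : ∀ {X Y Z : K} (F : Frac W X Y) {G₁ G₂ : Frac W Y Z} (r : Rep G₁ G₂),
    S.whiskerLeft F r.cell = ((leftFilling hW C D F r).rep hW).cell
  whiskerRight_eq : ∀ {X Y Z : K} {F₁ F₂ : Frac W X Y} (r : Rep F₁ F₂) (G : Frac W Y Z),
    S.whiskerRight r.cell G = ((rightFilling hW C D r G).rep hW).cell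
  hcomp_eq : ∀ {X Y Z : K} {F₁ F₂ : Frac W X Y} {G₁ G₂ : Frac W Y Z} (Φ : Cell F₁ F₂)
    (Ψ : Cell G₁ G₂), S.hcomp Φ Ψ = S.vcomp (S.whiskerRight Φ G₁) (S.whiskerLeft F₂ Ψ)
  associator_eq : ∀ {X Y Z T : K} (F : Frac W X Y) (G : Frac W Y Z) (H : Frac W Z T),
    S.associator F G H = (assocFilling hW C D F G H).rep.cell
  leftUnitor_eq : ∀ {X Y : K} (F : Frac W X Y), S.leftUnitor F = (leftUnitorRep hW C F).cell
  rightUnitor_eq : ∀ {X Y : K} (F : Frac W X Y), S.rightUnitor F = (rightUnitorRep hW C F).cell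

/-- Associators, vertical compositions and whiskerings of `S` are represented by the diagrams
built from any admissible data whatsoever, whether or not these come from choices `D(W)`. -/
structure Ops.IsChoiceFree {hW : BF W} {C : CChoices W} (S : Ops hW C) : Prop where
  vcomp_eq : ∀ {X Y : K} {F₁ F₂ F₃ : Frac W X Y} (r : Rep F₁ F₂) (s : Rep F₂ F₃)
    (P : VertFilling r s), S.vcomp r.cell s.cell = P.rep.cell
  whiskerLeft_eq : ∀ {X Y Z : K} (F : Frac W X Y) {G₁ G₂ : Frac W Y Z} (r : Rep G₁ G₂)
    (P : LeftFilling C F r), P.Valid → S.whiskerLeft F r.cell = (P.rep hW).cell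
  whiskerRight_eq : ∀ {X Y Z : K} {F₁ F₂ : Frac W X Y} (r : Rep F₁ F₂) (G : Frac W Y Z)
    (P : RightFilling C r G), P.Valid → S.whiskerRight r.cell G = (P.rep hW).cell
  associator_eq : ∀ {X Y Z T : K} (F : Frac W X Y) (G : Frac W Y Z) (H : Frac W Z T)
    (P : AssocFilling hW C F G H), P.Valid → S.associator F G H = P.rep.cell

end BiFrac

namespace BiFrac

variable {K : Type u} [Bicategory.{w, v} K] {W : MorphismProperty K}

/-! Everything rests on one property, `LocallyFF`: after restriction along morphisms of `W`,
postcomposition with `x` is full on invertible 2-morphisms and faithful on all of them. Morphisms of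
`W` have it: fullness is (BF4a,b), faithfulness follows from (BF4c) (`BF.locallyFF_of_mem`). It
passes from `x ≫ y` and `y` to `x` (`LocallyFF.of_comp`), so the legs of a representative have it as
well, although only their composites with the left legs of the fractions are known to lie in `W`.

Two fillings of the same shape are compared by diagram chasing. (BF3) and fullness give a common
refinement `E` of the domains with an isomorphism `κ` between the two restricted first legs
(`LocallyFF.exists_refinement`). The relation `Sq` says that isomorphisms of legs intertwine
corresponding 2-morphisms of the two diagrams. Along an invertible 2-morphism, fullness carries `κ`
to the next leg at the cost of a further refinement (`LocallyFF.exists_sq`). For a 2-morphism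
constrained by a pasting equation, the equation gives the square after whiskering, and faithfulness
removes the whiskering (`LocallyFF.sq_of_rwhisker`). Once all 2-morphisms are intertwined, so are
both components of the representatives, and the classes agree (`Rep.cell_eq`).

For independence of representatives, one instance of `Rep.Rel` is turned into a span of morphisms of
representatives `r ⟵ q ⟶ r'`. A filling for `q` is transported to `r` and to `r'` without changing
its class, and independence of the filling does the rest. Since `Cell` is a `Quot`, transitivity of
`Rep.Rel` is never needed.

The operations built from one `D(W)` thus agree with those built from any admissible data, in
particular with those of every other `D(W)`. They are determined by their values on representatives.
-/

/-! ### Squares of 2-morphisms -/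

/-- Right whiskering of a 2-morphism between composites, rebracketed. -/
def rwhisker {E S T Y Z : K} {a : E ⟶ S} {b : E ⟶ T} {x : S ⟶ Y} {y : T ⟶ Y} (θ : a ≫ x ⟶ b ≫ y)
    (g : Y ⟶ Z) : a ≫ x ≫ g ⟶ b ≫ y ≫ g :=
  (α_ a x g).inv ≫ θ ▷ g ≫ (α_ b y g).hom

/-- The invertible version of `rwhisker`. -/
def rwhiskerIso {E S T Y Z : K} {a : E ⟶ S} {b : E ⟶ T} {x : S ⟶ Y} {y : T ⟶ Y} (θ : a ≫ x ≅ b ≫ y)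
    (g : Y ⟶ Z) : a ≫ x ≫ g ≅ b ≫ y ≫ g where
  hom := rwhisker θ.hom g
  inv := rwhisker θ.inv g
  hom_inv_id := by simp [rwhisker, ← comp_whiskerRight_assoc]
  inv_hom_id := by simp [rwhisker, ← comp_whiskerRight_assoc]

@[simp]
theorem rwhiskerIso_hom {E S T Y Z : K} {a : E ⟶ S} {b : E ⟶ T} {x : S ⟶ Y} {y : T ⟶ Y}
    (θ : a ≫ x ≅ b ≫ y) (g : Y ⟶ Z) : (rwhiskerIso θ g).hom = rwhisker θ.hom g :=
  rfl

theorem rwhisker_hom_inv_assoc {E S T Y Z : K} {a : E ⟶ S} {b : E ⟶ T} {x : S ⟶ Y} {y : T ⟶ Y}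
    (θ : a ≫ x ≅ b ≫ y) (g : Y ⟶ Z) {c : E ⟶ Z} (χ : a ≫ x ≫ g ⟶ c) :
    rwhisker θ.hom g ≫ rwhisker θ.inv g ≫ χ = χ :=
  (rwhiskerIso θ g).hom_inv_id_assoc χ

theorem rwhisker_inv_hom_assoc {E S T Y Z : K} {a : E ⟶ S} {b : E ⟶ T} {x : S ⟶ Y} {y : T ⟶ Y}
    (θ : a ≫ x ≅ b ≫ y) (g : Y ⟶ Z) {c : E ⟶ Z} (χ : b ≫ y ≫ g ⟶ c) :
    rwhisker θ.inv g ≫ rwhisker θ.hom g ≫ χ = χ :=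
  (rwhiskerIso θ g).inv_hom_id_assoc χ

theorem rwhisker_comp {E S T U Y Z : K} {a : E ⟶ S} {b : E ⟶ T} {c : E ⟶ U} {x : S ⟶ Y} {y : T ⟶ Y}
    {z : U ⟶ Y} (θ : a ≫ x ⟶ b ≫ y) (χ : b ≫ y ⟶ c ≫ z) (g : Y ⟶ Z) :
    rwhisker (θ ≫ χ) g = rwhisker θ g ≫ rwhisker χ g := by
  simp [rwhisker]

/-- Restriction of an isomorphism along `d`. -/
def restrict {E' E Q Q' S : K} (d : E' ⟶ E) {e : E ⟶ Q} {e' : E ⟶ Q'} {a : Q ⟶ S} {a' : Q' ⟶ S}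
    (κ : e ≫ a ≅ e' ≫ a') : (d ≫ e) ≫ a ≅ (d ≫ e') ≫ a' :=
  α_ d e a ≪≫ whiskerLeftIso d κ ≪≫ (α_ d e' a').symm

/-- Restriction of an isomorphism between composites along `d`. -/
def restrictLegs {E Q S T Y : K} (d : E ⟶ Q) {a : Q ⟶ S} {b : Q ⟶ T} {x : S ⟶ Y} {y : T ⟶ Y}
    (θ : a ≫ x ≅ b ≫ y) : (d ≫ a) ≫ x ≅ (d ≫ b) ≫ y :=
  α_ d a x ≪≫ whiskerLeftIso d θ ≪≫ (α_ d b y).symm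

section Sq

variable {E Q Q' S T U Y Z : K} {e : E ⟶ Q} {e' : E ⟶ Q'} {a : Q ⟶ S} {a' : Q' ⟶ S} {b : Q ⟶ T}
  {b' : Q' ⟶ T} {c : Q ⟶ U} {c' : Q' ⟶ U} {x : S ⟶ Y} {y : T ⟶ Y} {z : U ⟶ Y}

/-- The isomorphisms `κ` and `μ` intertwine the 2-morphisms `θ` and `θ'`. -/
def Sq (κ : e ≫ a ≅ e' ≫ a') (θ : a ≫ x ⟶ b ≫ y) (θ' : a' ≫ x ⟶ b' ≫ y)
    (μ : e ≫ b ≅ e' ≫ b') : Prop :=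
  rwhisker κ.hom x ≫ e' ◁ θ' = e ◁ θ ≫ rwhisker μ.hom y

/-- Together with `Sq.whiskerLeft` and `Sq.rwhisker`, this shows that a pasting intertwines as soon
as its varying pieces do. -/
theorem Sq.comp {κ : e ≫ a ≅ e' ≫ a'} {θ : a ≫ x ⟶ b ≫ y} {θ' : a' ≫ x ⟶ b' ≫ y}
    {μ : e ≫ b ≅ e' ≫ b'} {χ : b ≫ y ⟶ c ≫ z} {χ' : b' ≫ y ⟶ c' ≫ z}
    {ν : e ≫ c ≅ e' ≫ c'} (h : Sq κ θ θ' μ) (h' : Sq μ χ χ' ν) :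
    Sq κ (θ ≫ χ) (θ' ≫ χ') ν := by
  unfold Sq at *
  rw [Bicategory.whiskerLeft_comp, reassoc_of% h, h', Bicategory.whiskerLeft_comp, Category.assoc]

theorem Sq.congr {κ : e ≫ a ≅ e' ≫ a'} {θ χ : a ≫ x ⟶ b ≫ y} {θ' χ' : a' ≫ x ⟶ b' ≫ y}
    {μ : e ≫ b ≅ e' ≫ b'} (h : Sq κ χ χ' μ) (hθ : θ = χ) (hθ' : θ' = χ') : Sq κ θ θ' μ := by
  rwa [hθ, hθ']

theorem Sq.inv {κ : e ≫ a ≅ e' ≫ a'} {θ : a ≫ x ≅ b ≫ y} {θ' : a' ≫ x ≅ b' ≫ y}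
    {μ : e ≫ b ≅ e' ≫ b'} (h : Sq κ θ.hom θ'.hom μ) : Sq μ θ.inv θ'.inv κ := by
  unfold Sq at *
  rw [← cancel_epi (e ◁ θ.hom), ← reassoc_of% h, whiskerLeft_hom_inv, whiskerLeft_hom_inv_assoc,
    Category.comp_id]

theorem Sq.rwhisker {κ : e ≫ a ≅ e' ≫ a'} {θ : a ≫ x ⟶ b ≫ y} {θ' : a' ≫ x ⟶ b' ≫ y}
    {μ : e ≫ b ≅ e' ≫ b'} (h : Sq κ θ θ' μ) (g : Y ⟶ Z) :
    Sq κ (BiFrac.rwhisker θ g) (BiFrac.rwhisker θ' g) μ := by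
  unfold Sq at *
  calc _ = e ◁ (α_ a x g).inv ≫ (α_ _ _ _).inv ≫ (BiFrac.rwhisker κ.hom x ≫ e' ◁ θ') ▷ g ≫ (α_ _ _ _).hom
        ≫ e' ◁ (α_ _ _ _).hom := by unfold BiFrac.rwhisker; bicategory
    _ = _ := by rw [h]; unfold BiFrac.rwhisker; bicategory

/-- This is the interchange law. It disposes of every piece common to two diagrams, such as the
squares of `C(W)` and the components of a fixed representative. -/
theorem Sq.whiskerLeft (κ : e ≫ a ≅ e' ≫ a') {x y : S ⟶ Y} (χ : x ⟶ y) :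
    Sq κ (a ◁ χ) (a' ◁ χ) κ := by
  unfold Sq BiFrac.rwhisker
  calc _ = (α_ e a x).inv ≫ (κ.hom ▷ x ≫ (e' ≫ a') ◁ χ) ≫ (α_ _ _ _).hom := by bicategory
    _ = _ := by rw [← whisker_exchange]; bicategory

/-- Squares already found survive the later refinements. -/
theorem Sq.restrict {κ : e ≫ a ≅ e' ≫ a'} {θ : a ≫ x ⟶ b ≫ y} {θ' : a' ≫ x ⟶ b' ≫ y}
    {μ : e ≫ b ≅ e' ≫ b'} (h : Sq κ θ θ' μ) {E' : K} (d : E' ⟶ E) :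
    Sq (restrict d κ) θ θ' (restrict d μ) := by
  unfold Sq at *
  calc _ = (α_ _ _ _).hom ≫ d ◁ (BiFrac.rwhisker κ.hom x ≫ e' ◁ θ') ≫ (α_ _ _ _).inv := by
        simp only [BiFrac.rwhisker, BiFrac.restrict, Iso.trans_hom, whiskerLeftIso_hom, Iso.symm_hom]
        bicategory
    _ = _ := by
        rw [h]; simp only [BiFrac.rwhisker, BiFrac.restrict, Iso.trans_hom, whiskerLeftIso_hom, Iso.symm_hom]
        bicategory

/-- Legs of the form `a ≫ x` may be split. -/
theorem Sq.of_assoc {Y Y' : K} {x : S ⟶ Y} {y : T ⟶ Y'} {g : Y ⟶ Z} {h : Y' ⟶ Z}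
    {κ : e ≫ a ≅ e' ≫ a'}
    {θ : (a ≫ x) ≫ g ⟶ (b ≫ y) ≫ h} {θ' : (a' ≫ x) ≫ g ⟶ (b' ≫ y) ≫ h}
    {χ : a ≫ x ≫ g ⟶ b ≫ y ≫ h} {χ' : a' ≫ x ≫ g ⟶ b' ≫ y ≫ h}
    {μ : e ≫ b ≅ e' ≫ b'} (H : Sq κ χ χ' μ) (hθ : θ = (α_ _ _ _).hom ≫ χ ≫ (α_ _ _ _).inv)
    (hθ' : θ' = (α_ _ _ _).hom ≫ χ' ≫ (α_ _ _ _).inv) :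
    Sq (rwhiskerIso κ x) θ θ' (rwhiskerIso μ y) := by
  subst hθ hθ'
  unfold Sq at *
  calc _ = e ◁ (α_ _ _ _).hom ≫ (BiFrac.rwhisker κ.hom (x ≫ g) ≫ e' ◁ χ') ≫ e' ◁ (α_ _ _ _).inv := by
        simp only [BiFrac.rwhisker, rwhiskerIso_hom]; bicategory
    _ = _ := by
        rw [H]; simp only [BiFrac.rwhisker, rwhiskerIso_hom]; bicategory

end Sq

/-! ### Morphisms that are fully faithful up to refinement -/

/-- A morphism `x` such that postcomposition with `x` is full and faithful on 2-morphisms after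
restriction along morphisms of `W`. -/
structure LocallyFF (W : MorphismProperty K) {S Y : K} (x : S ⟶ Y) : Prop where
  full : ∀ {Q : K} (f₁ f₂ : Q ⟶ S) (α : f₁ ≫ x ≅ f₂ ≫ x), ∃ (E : K) (d : E ⟶ Q)
    (β : d ≫ f₁ ≅ d ≫ f₂), W d ∧ d ◁ α.hom = rwhisker β.hom x
  faithful : ∀ {Q : K} {f₁ f₂ : Q ⟶ S} (β β' : f₁ ⟶ f₂), β ▷ x = β' ▷ x →
    ∃ (E : K) (d : E ⟶ Q), W d ∧ d ◁ β = d ◁ β'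

theorem CellLift.fac_rwhisker {X Y Z : K} {u : Y ⟶ Z} {f₁ f₂ : X ⟶ Y} {α : f₁ ≫ u ⟶ f₂ ≫ u}
    (L : CellLift W u f₁ f₂ α) : L.v ◁ α = rwhisker L.β u := by
  rw [L.fac]; unfold rwhisker; bicategory

/-- For faithfulness, `β` and `β'` both lift the same 2-morphism `β ▷ u` along an identity, and
(BF4c) compares these two lifts. -/
theorem BF.locallyFF_of_mem (hW : BF W) {S Y : K} {u : S ⟶ Y} (hu : W u) : LocallyFF W u where
  full f₁ f₂ α := by
    obtain ⟨L, hL⟩ := hW.bf4ab u hu f₁ f₂ α.hom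
    have := hL inferInstance
    exact ⟨L.pt, L.v, asIso L.β, L.v_mem, L.fac_rwhisker⟩
  faithful {Q f₁ f₂} β β' h := by
    obtain ⟨E, t, t', ζ, hm, hζ⟩ := hW.bf4c u hu f₁ f₂ (β ▷ u)
      ⟨Q, 𝟙 Q, hW.bf1 Q, 𝟙 Q ◁ β, by bicategory⟩ ⟨Q, 𝟙 Q, hW.bf1 Q, 𝟙 Q ◁ β', by rw [h]; bicategory⟩
    refine ⟨E, t ≫ 𝟙 Q, hm, ?_⟩
    -- The isomorphism `ζ` from (BF4c) need not be an identity; exchanging it with `β'` puts it on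
    -- the same side in both terms, where it cancels.
    rw [← cancel_mono (ζ.hom ▷ f₂), whisker_exchange _ β']
    calc _ = 𝟙 ((t ≫ 𝟙 Q) ≫ f₁) ⊗≫ t ◁ (𝟙 Q ◁ β) ⊗≫ ζ.hom ▷ f₂ := by bicategory
      _ = _ := by rw [← hζ]; bicategory

/-- For fullness, whisker with `y` and lift along `x ≫ y`. The result solves the problem for `x`
only after whiskering with `y`, which faithfulness of `y` removes on a refinement. -/
theorem LocallyFF.of_comp (hW : BF W) {S Y Z : K} {x : S ⟶ Y} {y : Y ⟶ Z}
    (hxy : LocallyFF W (x ≫ y)) (hy : LocallyFF W y) : LocallyFF W x where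
  full {Q} f₁ f₂ α := by
    obtain ⟨E, d, β, hd, hβ⟩ := hxy.full f₁ f₂ (rwhiskerIso α y)
    obtain ⟨E', d', hd', h⟩ := hy.faithful (rwhisker β.hom x) (d ◁ α.hom) (by
      calc _ = (α_ _ _ _).hom ≫ d ◁ (α_ _ _ _).hom ≫ (rwhisker β.hom (x ≫ y)) ≫ d ◁ (α_ _ _ _).inv ≫
            (α_ _ _ _).inv := by unfold rwhisker; bicategory
        _ = _ := by rw [← hβ, rwhiskerIso_hom]; unfold rwhisker; bicategory)
    refine ⟨E', d' ≫ d, restrict d' β, hW.bf2 _ _ hd' hd, ?_⟩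
    calc _ = (α_ _ _ _).hom ≫ d' ◁ (d ◁ α.hom) ≫ (α_ _ _ _).inv := by bicategory
      _ = _ := by
        rw [← h]
        simp only [rwhisker, restrict, Iso.trans_hom, whiskerLeftIso_hom, Iso.symm_hom]
        bicategory
  faithful {Q f₁ f₂} β β' h := hxy.faithful β β' (by
    rw [whiskerRight_comp, whiskerRight_comp, h])

/-- The leg `r.v₁` itself need not lie in `W`, so cancellation is needed here. -/
theorem Rep.locallyFF₁ (hW : BF W) {A B : K} {F₁ F₂ : Frac W A B} (r : Rep F₁ F₂) :
    LocallyFF W r.v₁ :=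
  .of_comp hW (hW.locallyFF_of_mem r.mem) (hW.locallyFF_of_mem F₁.w_mem)

/-- Two morphisms that lie in `W` after composition with `u` have a common refinement. -/
theorem LocallyFF.exists_refinement (hW : BF W) {X X' Z Y : K} {u : Z ⟶ Y} (hu : LocallyFF W u)
    {x : X ⟶ Z} {x' : X' ⟶ Z} (hx' : W (x' ≫ u)) :
    ∃ (E : K) (e : E ⟶ X) (e' : E ⟶ X') (_ : e ≫ x ≅ e' ≫ x'), W e := by
  obtain ⟨q⟩ := hW.bf3 (x ≫ u) (x' ≫ u) hx'
  obtain ⟨E, d, β, hd, -⟩ := hu.full (q.fst ≫ x) (q.snd ≫ x')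
    (α_ _ _ _ ≪≫ q.iso ≪≫ (α_ _ _ _).symm)
  exact ⟨E, d ≫ q.fst, d ≫ q.snd, α_ _ _ _ ≪≫ β ≪≫ (α_ _ _ _).symm, hW.bf2 _ _ hd q.fst_mem⟩

/-! ### Propagating intertwining isomorphisms through a diagram -/

section Sq

variable {E Q Q' S T Y Z : K} {e : E ⟶ Q} {e' : E ⟶ Q'} {a : Q ⟶ S} {a' : Q' ⟶ S} {b : Q ⟶ T}
  {b' : Q' ⟶ T} {x : S ⟶ Y} {y : T ⟶ Y}

/-- After a refinement, an intertwining isomorphism can be found on one side. -/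
theorem LocallyFF.exists_sq (hy : LocallyFF W y) (κ : e ≫ a ≅ e' ≫ a') (θ : a ≫ x ≅ b ≫ y)
    (θ' : a' ≫ x ≅ b' ≫ y) :
    ∃ (E' : K) (d : E' ⟶ E) (μ : (d ≫ e) ≫ b ≅ (d ≫ e') ≫ b'), W d ∧
      Sq (restrict d κ) θ.hom θ'.hom μ := by
  -- The square forces the whiskering of `μ` with `y` to be the composite of `θ⁻¹`, `κ` and `θ'`;
  -- fullness lifts this composite.
  obtain ⟨E', d, β, hd, h⟩ := hy.full (e ≫ b) (e' ≫ b') (α_ _ _ _ ≪≫ whiskerLeftIso e θ.symm ≪≫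
    rwhiskerIso κ x ≪≫ whiskerLeftIso e' θ' ≪≫ (α_ _ _ _).symm)
  refine ⟨E', d, α_ _ _ _ ≪≫ β ≪≫ (α_ _ _ _).symm, hd, ?_⟩
  simp only [Iso.trans_hom, whiskerLeftIso_hom, Iso.symm_hom, rwhiskerIso_hom] at h
  unfold Sq
  rw [← cancel_epi ((d ≫ e) ◁ θ.inv), whiskerLeft_inv_hom_assoc]
  calc _ = (α_ _ _ _).hom ≫ d ◁ (α_ _ _ _).inv ≫ (d ◁ ((α_ _ _ _).hom ≫ e ◁ θ.inv ≫
        rwhisker κ.hom x ≫ e' ◁ θ'.hom ≫ (α_ _ _ _).inv)) ≫ d ◁ (α_ _ _ _).hom ≫ (α_ _ _ _).inv := by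
        simp only [rwhisker, restrict, Iso.trans_hom, whiskerLeftIso_hom, Iso.symm_hom]
        bicategory
    _ = _ := by
        rw [h]
        simp only [rwhisker, Iso.trans_hom, Iso.symm_hom]; bicategory

/-- After a refinement, intertwining can be tested after whiskering with `w`. -/
theorem LocallyFF.sq_of_rwhisker {w : Y ⟶ Z} (hw : LocallyFF W w) {κ : e ≫ a ≅ e' ≫ a'}
    {θ : a ≫ x ⟶ b ≫ y} {θ' : a' ≫ x ⟶ b' ≫ y} {μ : e ≫ b ≅ e' ≫ b'}
    (h : Sq κ (rwhisker θ w) (rwhisker θ' w) μ) :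
    ∃ (E' : K) (d : E' ⟶ E), W d ∧ Sq (restrict d κ) θ θ' (restrict d μ) := by
  obtain ⟨E', d, hd, hβ⟩ := hw.faithful (rwhisker κ.hom x ≫ e' ◁ θ') (e ◁ θ ≫ rwhisker μ.hom y) (by
    unfold Sq at h
    calc _ = (α_ _ _ _).hom ≫ e ◁ (α_ _ _ _).hom ≫ (rwhisker κ.hom (x ≫ w) ≫ e' ◁ rwhisker θ' w) ≫
          e' ◁ (α_ _ _ _).inv ≫ (α_ _ _ _).inv := by unfold rwhisker; bicategory
      _ = _ := by rw [h]; unfold rwhisker; bicategory)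
  refine ⟨E', d, hd, ?_⟩
  unfold Sq
  calc _ = (α_ _ _ _).hom ≫ d ◁ (rwhisker κ.hom x ≫ e' ◁ θ') ≫ (α_ _ _ _).inv := by
        simp only [rwhisker, restrict, Iso.trans_hom, whiskerLeftIso_hom, Iso.symm_hom]
        bicategory
    _ = _ := by
        rw [hβ]; simp only [rwhisker, restrict, Iso.trans_hom, whiskerLeftIso_hom, Iso.symm_hom]
        bicategory

end Sq

/-! ### Equality of 2-morphisms of the bicategory of fractions -/

theorem Rep.cell_eq {A B : K} {F₁ F₂ : Frac W A B} {r r' : Rep F₁ F₂} {E : K} {e : E ⟶ r.pt}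
    {e' : E ⟶ r'.pt} {κ : e ≫ r.v₁ ≅ e' ≫ r'.v₁} {μ : e ≫ r.v₂ ≅ e' ≫ r'.v₂}
    (hm : W (e ≫ r.v₁ ≫ F₁.w)) (hα : Sq κ r.α.hom r'.α.hom μ) (hβ : Sq κ r.β r'.β μ) :
    r.cell = r'.cell := by
  -- Stated for arbitrary `x` and `y`, so that it serves both components: the left legs of the
  -- fractions for `α`, the right legs for `β`.
  have key : ∀ {Y : K} {x : F₁.pt ⟶ Y} {y : F₂.pt ⟶ Y} {θ : r.v₁ ≫ x ⟶ r.v₂ ≫ y}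
      {θ' : r'.v₁ ≫ x ⟶ r'.v₂ ≫ y}, Sq κ θ θ' μ → κ.inv ▷ x ⊗≫ e ◁ θ ⊗≫ μ.hom ▷ y =
      𝟙 ((e' ≫ r'.v₁) ≫ x) ⊗≫ e' ◁ θ' ⊗≫ 𝟙 ((e' ≫ r'.v₂) ≫ y) := by
    intro Y x y θ θ' h
    unfold Sq rwhisker at h
    calc _ = κ.inv ▷ x ⊗≫ (e ◁ θ ≫ (α_ _ _ _).inv ≫ μ.hom ▷ y ≫ (α_ _ _ _).hom) ⊗≫ 𝟙 _ := by
          bicategory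
      _ = (κ.inv ≫ κ.hom) ▷ x ⊗≫ e' ◁ θ' ⊗≫ 𝟙 _ := by rw [← h]; bicategory
      _ = _ := by rw [κ.inv_hom_id]; bicategory
  exact Quot.sound ⟨E, e, e', κ.symm, μ, hm, key hα, key hβ⟩

/-- A morphism of representatives: `r` is isomorphic to the restriction of `s` along `z`. -/
structure Rep.Hom {A B : K} {F₁ F₂ : Frac W A B} (r s : Rep F₁ F₂) where
  z : r.pt ⟶ s.pt
  τ₁ : r.v₁ ≅ z ≫ s.v₁
  τ₂ : r.v₂ ≅ z ≫ s.v₂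
  hα : r.α.hom ≫ τ₂.hom ▷ F₂.w = τ₁.hom ▷ F₁.w ≫ (α_ _ _ _).hom ≫ z ◁ s.α.hom ≫ (α_ _ _ _).inv
  hβ : r.β ≫ τ₂.hom ▷ F₂.f = τ₁.hom ▷ F₁.f ≫ (α_ _ _ _).hom ≫ z ◁ s.β ≫ (α_ _ _ _).inv

/-- The middle representative is the restriction of `r` along `z`. Its morphism to `r` is strict,
and the one to `r'` is given by `σ₁` and `σ₂`. -/
theorem Rep.Rel.exists_hom (hW : BF W) {A B : K} {F₁ F₂ : Frac W A B} {r r' : Rep F₁ F₂}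
    (h : r.Rel r') : ∃ q : Rep F₁ F₂, Nonempty (q.Hom r) ∧ Nonempty (q.Hom r') := by
  obtain ⟨E, z, z', σ₁, σ₂, hm, hα, hβ⟩ := h
  have key : ∀ {Y : K} {x : F₁.pt ⟶ Y} {y : F₂.pt ⟶ Y} {θ : r.v₁ ≫ x ⟶ r.v₂ ≫ y}
      {θ' : r'.v₁ ≫ x ⟶ r'.v₂ ≫ y}, σ₁.hom ▷ x ⊗≫ z ◁ θ ⊗≫ σ₂.hom ▷ y =
      𝟙 ((z' ≫ r'.v₁) ≫ x) ⊗≫ z' ◁ θ' ⊗≫ 𝟙 ((z' ≫ r'.v₂) ≫ y) →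
      ((α_ _ _ _).hom ≫ z ◁ θ ≫ (α_ _ _ _).inv) ≫ σ₂.hom ▷ y =
      σ₁.inv ▷ x ≫ (α_ _ _ _).hom ≫ z' ◁ θ' ≫ (α_ _ _ _).inv := by
    intro Y x y θ θ' h
    rw [← cancel_epi (σ₁.hom ▷ x), hom_inv_whiskerRight_assoc]
    calc _ = σ₁.hom ▷ x ⊗≫ z ◁ θ ⊗≫ σ₂.hom ▷ y := by bicategory
      _ = _ := by rw [h]; bicategory
  exact ⟨⟨E, z ≫ r.v₁, z ≫ r.v₂, α_ _ _ _ ≪≫ whiskerLeftIso z r.α ≪≫ (α_ _ _ _).symm,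
    (α_ _ _ _).hom ≫ z ◁ r.β ≫ (α_ _ _ _).inv, hW.mem_of_iso (α_ _ _ _) hm⟩,
    ⟨⟨z, Iso.refl _, Iso.refl _, by simp, by simp⟩⟩,
    ⟨⟨z', σ₁.symm, σ₂, key hα, key hβ⟩⟩⟩

theorem Rep.Hom.cell_eq (hW : BF W) {A B : K} {F₁ F₂ : Frac W A B} {r s : Rep F₁ F₂}
    (m : r.Hom s) : r.cell = s.cell := by
  refine Rep.cell_eq (e := 𝟙 r.pt) (e' := m.z) (κ := λ_ _ ≪≫ m.τ₁) (μ := λ_ _ ≪≫ m.τ₂)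
    (hW.bf2 _ _ (hW.bf1 _) r.mem) ?_ ?_ <;> unfold Sq
  · calc _ = (λ_ _).hom ≫ (m.τ₁.hom ▷ F₁.w ≫ (α_ _ _ _).hom ≫ m.z ◁ s.α.hom ≫ (α_ _ _ _).inv) ≫
          (α_ _ _ _).hom := by
          simp only [rwhisker, Iso.trans_hom]; bicategory
      _ = _ := by rw [← m.hα]; simp only [rwhisker, Iso.trans_hom]; bicategory
  · calc _ = (λ_ _).hom ≫ (m.τ₁.hom ▷ F₁.f ≫ (α_ _ _ _).hom ≫ m.z ◁ s.β ≫ (α_ _ _ _).inv) ≫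
          (α_ _ _ _).hom := by
          simp only [rwhisker, Iso.trans_hom]; bicategory
      _ = _ := by rw [← m.hβ]; simp only [rwhisker, Iso.trans_hom]; bicategory

/-! ### Vertical composition -/

namespace VertFilling

variable {A B : K} {F₁ F₂ F₃ : Frac W A B} {r r' : Rep F₁ F₂} {s s' : Rep F₂ F₃}

theorem rep_α (P : VertFilling r s) : P.rep.α.hom = (α_ _ _ _).hom ≫
    (P.t₁ ◁ r.α.hom ≫ rwhisker P.ρ.hom F₂.w ≫ P.t₂ ◁ s.α.hom) ≫ (α_ _ _ _).inv := by
  simp only [VertFilling.rep, bicategoricalIsoComp, Iso.trans_hom, Iso.refl_hom,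
    whiskerLeftIso_hom, whiskerRightIso_hom, rwhisker]
  bicategory

theorem rep_β (P : VertFilling r s) : P.rep.β = (α_ _ _ _).hom ≫
    (P.t₁ ◁ r.β ≫ rwhisker P.ρ.hom F₂.f ≫ P.t₂ ◁ s.β) ≫ (α_ _ _ _).inv := by
  simp only [VertFilling.rep, rwhisker]
  bicategory

/-- No equation on `ρ` is required: fullness of `s.v₁` yields an isomorphism between the refined
second legs that carries one `ρ` to the other. -/
theorem cell_eq (hW : BF W) (P P' : VertFilling r s) : P.rep.cell = P'.rep.cell := by
  obtain ⟨E, e, e', κ, he⟩ := (hW.locallyFF_of_mem r.mem).exists_refinement hW (x := P.t₁)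
    (x' := P'.t₁) (hW.mem_of_iso (α_ _ _ _).symm P'.mem)
  obtain ⟨E', d, μ, hd, h⟩ := (s.locallyFF₁ hW).exists_sq κ P.ρ P'.ρ
  refine Rep.cell_eq (r := P.rep) (r' := P'.rep) (e := d ≫ e) (e' := d ≫ e')
    (κ := rwhiskerIso (restrict d κ) r.v₁) (μ := rwhiskerIso μ s.v₂)
    (hW.bf2 _ _ (hW.bf2 _ _ hd he) P.mem) (.of_assoc ?_ P.rep_α P'.rep_α)
    (.of_assoc ?_ P.rep_β P'.rep_β) <;>
  exact .comp (.whiskerLeft _ _) (.comp (h.rwhisker _) (.whiskerLeft _ _))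

/-- Transport of a filling along a morphism of the first representative. -/
def mapFst (hW : BF W) (m : r.Hom r') (P : VertFilling r s) : VertFilling r' s where
  pt := P.pt
  t₁ := P.t₁ ≫ m.z
  t₂ := P.t₂
  ρ := α_ _ _ _ ≪≫ whiskerLeftIso P.t₁ m.τ₂.symm ≪≫ P.ρ
  mem := hW.mem_of_iso (whiskerRightIso (α_ _ _ _ ≪≫ whiskerLeftIso P.t₁ m.τ₁.symm) _) P.mem

/-- Transport of a filling along a morphism of the second representative. -/
def mapSnd (m : s.Hom s') (P : VertFilling r s) : VertFilling r s' where
  pt := P.pt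
  t₁ := P.t₁
  t₂ := P.t₂ ≫ m.z
  ρ := P.ρ ≪≫ whiskerLeftIso P.t₂ m.τ₁ ≪≫ (α_ _ _ _).symm
  mem := P.mem

/-- The legs change only by `m.τ₁` and unitors. The inverse of `m.τ₂` built into the transported `ρ`
cancels the `m.τ₂` produced by the compatibility of `m`. -/
theorem cell_mapFst (hW : BF W) (m : r.Hom r') (P : VertFilling r s) :
    P.rep.cell = (P.mapFst hW m).rep.cell := by
  have key : ∀ {Y : K} {x : F₁.pt ⟶ Y} {y : F₂.pt ⟶ Y} {z : F₃.pt ⟶ Y} {θ : r.v₁ ≫ x ⟶ r.v₂ ≫ y}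
      {θ' : r'.v₁ ≫ x ⟶ r'.v₂ ≫ y} {χ : s.v₁ ≫ y ⟶ s.v₂ ≫ z}, θ ≫ m.τ₂.hom ▷ y =
      m.τ₁.hom ▷ x ≫ (α_ _ _ _).hom ≫ m.z ◁ θ' ≫ (α_ _ _ _).inv →
      ((α_ _ _ _).hom ≫ (P.t₁ ◁ θ ≫ rwhisker P.ρ.hom y ≫ P.t₂ ◁ χ) ≫ (α_ _ _ _).inv) ≫
        (λ_ (P.t₂ ≫ s.v₂)).inv ▷ z =
      (P.t₁ ◁ m.τ₁.hom ≫ (α_ _ _ _).inv ≫ (λ_ _).inv) ▷ x ≫ (α_ _ _ _).hom ≫ 𝟙 P.pt ◁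
        ((α_ _ _ _).hom ≫ ((P.t₁ ≫ m.z) ◁ θ' ≫
        rwhisker ((α_ _ _ _).hom ≫ P.t₁ ◁ m.τ₂.inv ≫ P.ρ.hom) y ≫ P.t₂ ◁ χ) ≫ (α_ _ _ _).inv) ≫
        (α_ _ _ _).inv := by
    intro Y x y z θ θ' χ h
    unfold rwhisker
    symm
    calc _ = 𝟙 _ ⊗≫ P.t₁ ◁ (m.τ₁.hom ▷ x ≫ (α_ _ _ _).hom ≫ m.z ◁ θ' ≫ (α_ _ _ _).inv) ⊗≫
          P.t₁ ◁ m.τ₂.inv ▷ y ⊗≫ P.ρ.hom ▷ y ⊗≫ P.t₂ ◁ χ ⊗≫ 𝟙 _ := by bicategory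
      _ = 𝟙 _ ⊗≫ P.t₁ ◁ (θ ≫ (m.τ₂.hom ≫ m.τ₂.inv) ▷ y) ⊗≫ P.ρ.hom ▷ y ⊗≫ P.t₂ ◁ χ ⊗≫ 𝟙 _ := by
          rw [← h]; bicategory
      _ = _ := by rw [m.τ₂.hom_inv_id]; bicategory
  refine Rep.Hom.cell_eq hW ⟨𝟙 P.pt, whiskerLeftIso P.t₁ m.τ₁ ≪≫ (α_ _ _ _).symm ≪≫ (λ_ _).symm,
    (λ_ _).symm, ?_, ?_⟩
  · rw [rep_α, rep_α]; exact key m.hα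
  · rw [rep_β, rep_β]; exact key m.hβ

theorem cell_mapSnd (hW : BF W) (m : s.Hom s') (P : VertFilling r s) :
    P.rep.cell = (P.mapSnd m).rep.cell := by
  have key : ∀ {Y : K} {x : F₁.pt ⟶ Y} {y : F₂.pt ⟶ Y} {z : F₃.pt ⟶ Y} {θ : s.v₁ ≫ y ⟶ s.v₂ ≫ z}
      {θ' : s'.v₁ ≫ y ⟶ s'.v₂ ≫ z} {χ : r.v₁ ≫ x ⟶ r.v₂ ≫ y}, θ ≫ m.τ₂.hom ▷ z =
      m.τ₁.hom ▷ y ≫ (α_ _ _ _).hom ≫ m.z ◁ θ' ≫ (α_ _ _ _).inv →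
      ((α_ _ _ _).hom ≫ (P.t₁ ◁ χ ≫ rwhisker P.ρ.hom y ≫ P.t₂ ◁ θ) ≫ (α_ _ _ _).inv) ≫
        (P.t₂ ◁ m.τ₂.hom ≫ (α_ _ _ _).inv ≫ (λ_ _).inv) ▷ z =
      (λ_ _).inv ▷ x ≫ (α_ _ _ _).hom ≫ 𝟙 P.pt ◁
        ((α_ _ _ _).hom ≫ (P.t₁ ◁ χ ≫
        rwhisker (P.ρ.hom ≫ P.t₂ ◁ m.τ₁.hom ≫ (α_ _ _ _).inv) y ≫
        (P.t₂ ≫ m.z) ◁ θ') ≫ (α_ _ _ _).inv) ≫ (α_ _ _ _).inv := by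
    intro Y x y z θ θ' χ h
    unfold rwhisker
    calc _ = 𝟙 _ ⊗≫ P.t₁ ◁ χ ⊗≫ P.ρ.hom ▷ y ⊗≫ P.t₂ ◁ (θ ≫ m.τ₂.hom ▷ z) ⊗≫ 𝟙 _ := by bicategory
      _ = _ := by rw [h]; bicategory
  refine Rep.Hom.cell_eq hW ⟨𝟙 P.pt, (λ_ _).symm,
    whiskerLeftIso P.t₂ m.τ₂ ≪≫ (α_ _ _ _).symm ≪≫ (λ_ _).symm,
    ?_, ?_⟩
  · rw [rep_α, rep_α]; exact key m.hα
  · rw [rep_β, rep_β]; exact key m.hβ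

end VertFilling

/-- Used when two representatives have definitionally equal legs, as for a filling and its reduced
form. -/
theorem Rep.cell_congr {A B : K} {F₁ F₂ : Frac W A B} {pt : K} {v₁ : pt ⟶ F₁.pt}
    {v₂ : pt ⟶ F₂.pt} {α α' : v₁ ≫ F₁.w ≅ v₂ ≫ F₂.w} {β β' : v₁ ≫ F₁.f ⟶ v₂ ≫ F₂.f}
    {h h' : W (v₁ ≫ F₁.w)} (hα : α.hom = α'.hom) (hβ : β = β') :
    (Rep.mk pt v₁ v₂ α β h).cell = (Rep.mk pt v₁ v₂ α' β' h').cell := by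
  rw [Iso.ext hα, hβ]

/-! ### Associators -/

namespace AssocFilling

variable {hW : BF W} {C : CChoices W} {X Y Z T : K} {F : Frac W X Y} {G : Frac W Y Z}
  {H : Frac W Z T}

theorem rep_α (P : AssocFilling hW C F G H) : P.rep.α.hom =
    P.u₄ ◁ (α_ _ _ _).inv ≫ rwhisker P.γ.hom F.w := by
  simp only [AssocFilling.rep, bicategoricalIsoComp, Iso.trans_hom, Iso.refl_hom,
    whiskerRightIso_hom, rwhisker]
  bicategory

theorem rep_β (P : AssocFilling hW C F G H) : P.rep.β =
    rwhisker P.ρ.hom H.f ≫ P.u₅ ◁ (α_ _ _ _).hom := by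
  simp only [AssocFilling.rep, rwhisker]
  bicategory

theorem Valid.rwhisker_ω {P : AssocFilling hW C F G H} (hP : P.Valid) : rwhisker P.ω.hom G.w =
    P.u₄ ◁ ((α_ _ _ _).hom ≫ (C.sqL F G H).fst ◁ (C.sq F G).iso.inv ≫ (α_ _ _ _).inv) ≫
    rwhisker P.γ.hom F.f ≫ P.u₅ ◁ ((C.sqR hW F G H).iso.hom ≫ (α_ _ _ _).inv) := by
  unfold rwhisker
  rw [hP.ω_eq]
  bicategory

theorem Valid.rwhisker_ρ {P : AssocFilling hW C F G H} (hP : P.Valid) : rwhisker P.ρ.hom H.w =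
    P.u₄ ◁ ((C.sqL F G H).iso.inv ≫ (α_ _ _ _).inv) ≫ rwhisker P.ω.hom G.f ≫
    P.u₅ ◁ ((α_ _ _ _).hom ≫ (C.sqR hW F G H).snd ◁ (C.sq G H).iso.hom ≫ (α_ _ _ _).inv) := by
  unfold rwhisker
  rw [hP.ρ_eq]
  bicategory

/-- Fullness along `γ` compares the legs `u₅`; then `ω` and `ρ` are determined by their pasting
equations up to refinement, by faithfulness of the left legs of `G` and `H`. -/
theorem cell_eq {P P' : AssocFilling hW C F G H} (hP : P.Valid) (hP' : P'.Valid) :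
    P.rep.cell = P'.rep.cell := by
  have hL := (compFrac hW C (compFrac hW C F G) H).w_mem
  obtain ⟨E₁, e, e', κ, he⟩ := (hW.locallyFF_of_mem hL).exists_refinement hW (x := P.u₄)
    (x' := P'.u₄) P'.mem
  obtain ⟨E₂, d, μ, hd, h⟩ :=
    (hW.locallyFF_of_mem (C.sqR hW F G H).fst_mem).exists_sq κ P.γ P'.γ
  have hω : Sq (restrict d κ) (rwhisker P.ω.hom G.w) (rwhisker P'.ω.hom G.w) μ := by
    rw [hP.rwhisker_ω, hP'.rwhisker_ω]
    exact .comp (.whiskerLeft _ _) (.comp (h.rwhisker _) (.whiskerLeft _ _))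
  obtain ⟨E₃, d', hd', hω⟩ := (hW.locallyFF_of_mem G.w_mem).sq_of_rwhisker hω
  have hρ : Sq (restrict d' (restrict d κ)) (rwhisker P.ρ.hom H.w) (rwhisker P'.ρ.hom H.w)
      (restrict d' μ) := by
    rw [hP.rwhisker_ρ, hP'.rwhisker_ρ]
    exact .comp (.whiskerLeft _ _) (.comp (hω.rwhisker _) (.whiskerLeft _ _))
  obtain ⟨E₄, d'', hd'', hρ⟩ := (hW.locallyFF_of_mem H.w_mem).sq_of_rwhisker hρ
  have hα : Sq (restrict d'' (restrict d' (restrict d κ)))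
      (P.u₄ ◁ (α_ _ _ _).inv ≫ rwhisker P.γ.hom F.w)
      (P'.u₄ ◁ (α_ _ _ _).inv ≫ rwhisker P'.γ.hom F.w) (restrict d'' (restrict d' μ)) :=
    .comp (.whiskerLeft _ _) (((h.restrict d').restrict d'').rwhisker _)
  have hβ : Sq (restrict d'' (restrict d' (restrict d κ)))
      (rwhisker P.ρ.hom H.f ≫ P.u₅ ◁ (α_ _ _ _).hom)
      (rwhisker P'.ρ.hom H.f ≫ P'.u₅ ◁ (α_ _ _ _).hom) (restrict d'' (restrict d' μ)) :=
    .comp (hρ.rwhisker _) (.whiskerLeft _ _)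
  exact Rep.cell_eq (r := P.rep) (r' := P'.rep)
    (hW.bf2 _ _ (hW.bf2 _ _ hd'' (hW.bf2 _ _ hd' (hW.bf2 _ _ hd he))) P.mem)
    (hα.congr P.rep_α P'.rep_α) (hβ.congr P.rep_β P'.rep_β)

/-- The equation for `ω` is the lifting property of `L` restricted along `M.v`; the equation for `ρ`
is the lifting property of `M`. -/
theorem valid_ofLifts
    (q : OreSquare W ((C.sqL F G H).fst ≫ (C.sq F G).fst) (C.sqR hW F G H).fst)
    (L : CellLift W G.w (q.fst ≫ (C.sqL F G H).fst ≫ (C.sq F G).snd)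
      (q.snd ≫ (C.sqR hW F G H).snd ≫ (C.sq G H).fst) (assocPasting₁ q).hom)
    (hL : IsIso L.β)
    (M : CellLift W H.w (L.v ≫ q.fst ≫ (C.sqL F G H).snd)
      (L.v ≫ q.snd ≫ (C.sqR hW F G H).snd ≫ (C.sq G H).snd)
      (assocPasting₂ q L.v (L.isoβ hL)).hom)
    (hM : IsIso M.β) : (ofLifts q L hL M hM).Valid := by
  constructor <;>
    simp only [ofLifts, bicategoricalIsoComp, Iso.trans_hom, Iso.refl_hom, whiskerLeftIso_hom,
      asIso_hom]
  · calc _ = 𝟙 _ ⊗≫ M.v ◁ (rwhisker L.β G.w) ⊗≫ 𝟙 _ := by unfold rwhisker; bicategory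
      _ = 𝟙 _ ⊗≫ M.v ◁ (L.v ◁ (assocPasting₁ q).hom) ⊗≫ 𝟙 _ :=
        congrArg (fun t => 𝟙 _ ⊗≫ M.v ◁ t ⊗≫ 𝟙 _) L.fac_rwhisker.symm
      _ = _ := by
        simp only [assocPasting₁, bicategoricalIsoComp, Iso.trans_hom, Iso.refl_hom,
          whiskerLeftIso_hom, whiskerRightIso_hom, Iso.symm_hom]
        bicategory
  · calc _ = 𝟙 _ ⊗≫ rwhisker M.β H.w ⊗≫ 𝟙 _ := by unfold rwhisker; bicategory
      _ = 𝟙 _ ⊗≫ M.v ◁ (assocPasting₂ q L.v (L.isoβ hL)).hom ⊗≫ 𝟙 _ :=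
        congrArg (fun t => 𝟙 _ ⊗≫ t ⊗≫ 𝟙 _) M.fac_rwhisker.symm
      _ = _ := by
        simp only [assocPasting₂, bicategoricalIsoComp, Iso.trans_hom, Iso.refl_hom,
          whiskerLeftIso_hom, whiskerRightIso_hom, Iso.symm_hom, asIso_hom]
        bicategory

end AssocFilling

/-! ### Transport of 2-morphisms along morphisms of representatives -/

namespace Rep.Hom

variable {A B : K} {F₁ F₂ : Frac W A B} {r s : Rep F₁ F₂} (m : r.Hom s)

/-- The isomorphism `τ₁`, restricted along `k`. -/
def τ₁Restrict {Q : K} (k : Q ⟶ r.pt) : k ≫ r.v₁ ≅ (k ≫ m.z) ≫ s.v₁ :=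
  whiskerLeftIso k m.τ₁ ≪≫ (α_ _ _ _).symm

/-- The isomorphism `τ₂`, restricted along `k`. -/
def τ₂Restrict {Q : K} (k : Q ⟶ r.pt) : k ≫ r.v₂ ≅ (k ≫ m.z) ≫ s.v₂ :=
  whiskerLeftIso k m.τ₂ ≪≫ (α_ _ _ _).symm

/-- This and its analogue for `β` allow the components of `r` to be exchanged for those of `s`
inside reduced data. -/
theorem rwhisker_τ₁Restrict_α {Q : K} (k : Q ⟶ r.pt) :
    rwhisker (m.τ₁Restrict k).hom F₁.w ≫ (k ≫ m.z) ◁ s.α.hom =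
    k ◁ r.α.hom ≫ rwhisker (m.τ₂Restrict k).hom F₂.w := by
  simp only [τ₁Restrict, τ₂Restrict, rwhisker, Iso.trans_hom, whiskerLeftIso_hom, Iso.symm_hom]
  calc _ = k ◁ (m.τ₁.hom ▷ F₁.w ≫ (α_ _ _ _).hom ≫ m.z ◁ s.α.hom ≫ (α_ _ _ _).inv) ≫
        k ◁ (α_ _ _ _).hom ≫ (α_ _ _ _).inv := by bicategory
    _ = _ := by rw [← m.hα]; bicategory

theorem rwhisker_τ₁Restrict_β {Q : K} (k : Q ⟶ r.pt) :
    rwhisker (m.τ₁Restrict k).hom F₁.f ≫ (k ≫ m.z) ◁ s.β =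
    k ◁ r.β ≫ rwhisker (m.τ₂Restrict k).hom F₂.f := by
  simp only [τ₁Restrict, τ₂Restrict, rwhisker, Iso.trans_hom, whiskerLeftIso_hom, Iso.symm_hom]
  calc _ = k ◁ (m.τ₁.hom ▷ F₁.f ≫ (α_ _ _ _).hom ≫ m.z ◁ s.β ≫ (α_ _ _ _).inv) ≫
        k ◁ (α_ _ _ _).hom ≫ (α_ _ _ _).inv := by bicategory
    _ = _ := by rw [← m.hβ]; bicategory

end Rep.Hom

/-! ### Whiskering with a morphism that is composed first -/

/-- A reduced form of a valid `LeftFilling`. -/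
structure LeftData (C : CChoices W) {X Y Z : K} (F : Frac W X Y) {G₁ G₂ : Frac W Y Z}
    (r : Rep G₁ G₂) where
  pt : K
  a₁ : pt ⟶ (C.sq F G₁).pt
  a₂ : pt ⟶ (C.sq F G₂).pt
  k : pt ⟶ r.pt
  σ₁ : a₁ ≫ (C.sq F G₁).snd ≅ k ≫ r.v₁
  σ₂ : a₂ ≫ (C.sq F G₂).snd ≅ k ≫ r.v₂
  φ : a₁ ≫ (C.sq F G₁).fst ≅ a₂ ≫ (C.sq F G₂).fst
  mem : W (a₁ ≫ (C.sq F G₁).fst ≫ F.w)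
  valid : rwhisker σ₂.hom G₂.w = a₂ ◁ (C.sq F G₂).iso.inv ≫ rwhisker φ.inv F.f ≫
    a₁ ◁ (C.sq F G₁).iso.hom ≫ rwhisker σ₁.hom G₁.w ≫ k ◁ r.α.hom

namespace LeftData

variable {C : CChoices W} {X Y Z : K} {F : Frac W X Y} {G₁ G₂ : Frac W Y Z} {r r' : Rep G₁ G₂}

/-- The representative given by reduced data. -/
def rep (hW : BF W) (P : LeftData C F r) : Rep (compFrac hW C F G₁) (compFrac hW C F G₂) where
  pt := P.pt
  v₁ := P.a₁
  v₂ := P.a₂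
  α := rwhiskerIso P.φ F.w
  β := rwhisker P.σ₁.hom G₁.f ≫ P.k ◁ r.β ≫ rwhisker P.σ₂.inv G₂.f
  mem := P.mem

theorem cell_eq (hW : BF W) (P P' : LeftData C F r) : (P.rep hW).cell = (P'.rep hW).cell := by
  obtain ⟨E₁, e, e', κ, he⟩ := (hW.locallyFF_of_mem (compFrac hW C F G₁).w_mem).exists_refinement
    hW (x := P.a₁) (x' := P'.a₁) P'.mem
  obtain ⟨E₂, d, μ, hd, h₁⟩ := (r.locallyFF₁ hW).exists_sq κ P.σ₁ P'.σ₁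
  -- The legs `k` have been compared through `σ₁`, and `a₂` is now compared through `φ`. This leaves
  -- `σ₂`, which `valid` expresses through the other data after whiskering with `G₂.w`.
  obtain ⟨E₃, d', ν, hd', hφ⟩ :=
    (hW.locallyFF_of_mem (C.sq F G₂).fst_mem).exists_sq (restrict d κ) P.φ P'.φ
  have h₁ := h₁.restrict d'
  have h₂ : Sq ν (rwhisker P.σ₂.hom G₂.w) (rwhisker P'.σ₂.hom G₂.w) (restrict d' μ) := by
    rw [P.valid, P'.valid]
    exact .comp (.whiskerLeft _ _) (.comp (hφ.inv.rwhisker _) (.comp (.whiskerLeft _ _)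
      (.comp (h₁.rwhisker _) (.whiskerLeft _ _))))
  obtain ⟨E₄, d'', hd'', h₂⟩ := (hW.locallyFF_of_mem G₂.w_mem).sq_of_rwhisker h₂
  exact Rep.cell_eq (r := P.rep hW) (r' := P'.rep hW)
    (hW.bf2 _ _ (hW.bf2 _ _ hd'' (hW.bf2 _ _ hd' (hW.bf2 _ _ hd he))) P.mem)
    ((hφ.restrict d'').rwhisker F.w)
    (.comp ((h₁.restrict d'').rwhisker G₁.f) (.comp (.whiskerLeft _ _) (h₂.inv.rwhisker G₂.f)))

/-- Transport of reduced data along a morphism of representatives. -/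
def map (m : r.Hom r') (P : LeftData C F r) : LeftData C F r' where
  pt := P.pt
  a₁ := P.a₁
  a₂ := P.a₂
  k := P.k ≫ m.z
  σ₁ := P.σ₁ ≪≫ m.τ₁Restrict P.k
  σ₂ := P.σ₂ ≪≫ m.τ₂Restrict P.k
  φ := P.φ
  mem := P.mem
  valid := by
    simp only [Iso.trans_hom, rwhisker_comp, Category.assoc, m.rwhisker_τ₁Restrict_α, P.valid]

theorem cell_map (hW : BF W) (m : r.Hom r') (P : LeftData C F r) :
    (P.rep hW).cell = ((P.map m).rep hW).cell :=
  Rep.cell_congr rfl (by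
    change rwhisker P.σ₁.hom G₁.f ≫ P.k ◁ r.β ≫ rwhisker P.σ₂.inv G₂.f =
      rwhisker (P.σ₁ ≪≫ m.τ₁Restrict P.k).hom G₁.f ≫ (P.k ≫ m.z) ◁ r'.β ≫
        rwhisker (P.σ₂ ≪≫ m.τ₂Restrict P.k).inv G₂.f
    simp only [Iso.trans_hom, Iso.trans_inv, rwhisker_comp,
      Category.assoc, reassoc_of% m.rwhisker_τ₁Restrict_β,
      rwhisker_hom_inv_assoc])

/-- The reduced form of a valid filling. -/
def ofFilling (P : LeftFilling C F r) (hP : P.Valid) : LeftData C F r where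
  pt := P.D₅
  a₁ := P.t₃ ≫ P.t₁
  a₂ := P.t₄ ≫ P.t₂
  k := P.t₄ ≫ P.h₂
  -- Absorbing `δ` into `σ₁` leaves a single leg `k` into `r.pt`; the condition on `δ` becomes a
  -- formula for `σ₂`.
  σ₁ := restrictLegs P.t₃ P.σ₁ ≪≫ whiskerRightIso P.δ r.v₁
  σ₂ := restrictLegs P.t₄ P.σ₂
  φ := α_ _ _ _ ≪≫ P.φ ≪≫ (α_ _ _ _).symm
  mem := P.mem
  valid := by
    have h : rwhisker (restrictLegs P.t₃ P.σ₁ ≪≫ whiskerRightIso P.δ r.v₁).hom G₁.w =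
        rwhisker (restrictLegs P.t₃ P.σ₁).hom G₁.w ≫ P.δ.hom ▷ (r.v₁ ≫ G₁.w) := by
      simp only [rwhisker, Iso.trans_hom, whiskerRightIso_hom]; bicategory
    -- Substituting this value of `δ` makes everything except `σ₂` cancel in pairs.
    have hδ : P.δ.hom ▷ (r.v₁ ≫ G₁.w) = rwhisker (restrictLegs P.t₃ P.σ₁).inv G₁.w ≫
        (P.t₃ ≫ P.t₁) ◁ (C.sq F G₁).iso.inv ≫
        rwhisker (α_ _ _ _ ≪≫ P.φ ≪≫ (α_ _ _ _).symm).hom F.f ≫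
        (P.t₄ ≫ P.t₂) ◁ (C.sq F G₂).iso.hom ≫ rwhisker (restrictLegs P.t₄ P.σ₂).hom G₂.w ≫
        (P.t₄ ≫ P.h₂) ◁ r.α.inv := by
      rw [hP]
      simp only [rwhisker, restrictLegs, Iso.trans_hom, Iso.trans_inv, Iso.symm_hom, Iso.symm_inv,
        whiskerLeftIso_hom, whiskerLeftIso_inv, Category.assoc]
      bicategory
    rw [h, hδ]
    simp only [Category.assoc, rwhisker_hom_inv_assoc, rwhisker_inv_hom_assoc, whiskerLeft_hom_inv_assoc,
      whiskerLeft_inv_hom_assoc, whiskerLeft_inv_hom, Category.comp_id]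

theorem cell_ofFilling (hW : BF W) (P : LeftFilling C F r) (hP : P.Valid) :
    (P.rep hW).cell = ((ofFilling P hP).rep hW).cell :=
  Rep.cell_congr
    (by
      simp only [ofFilling, rwhiskerIso_hom, rwhisker, bicategoricalIsoComp, Iso.trans_hom, Iso.refl_hom,
        Iso.symm_hom, whiskerRightIso_hom]
      bicategory)
    (by
      simp only [ofFilling, rwhisker, restrictLegs, Iso.trans_hom, Iso.trans_inv, Iso.symm_hom, Iso.symm_inv,
        whiskerLeftIso_hom, whiskerLeftIso_inv, whiskerRightIso_hom, Category.assoc]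
      bicategory)

end LeftData

theorem LeftFilling.valid_ofLift (hW : BF W) {C : CChoices W} {X Y Z : K} {F : Frac W X Y}
    {G₁ G₂ : Frac W Y Z} {r : Rep G₁ G₂} (m : HalfFilling C F G₁ r.v₁)
    (n : HalfFilling C F G₂ r.v₂)
    (q : OreSquare W (m.t ≫ (C.sq F G₁).fst) (n.t ≫ (C.sq F G₂).fst))
    (L : CellLift W (r.v₁ ≫ G₁.w) (q.fst ≫ m.h) (q.snd ≫ n.h) (leftPasting m n q).hom)
    (hL : IsIso L.β) : (LeftFilling.ofLift hW m n q L hL).Valid := by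
  have h := L.fac_rwhisker
  unfold LeftFilling.Valid
  simp only [ofLift, bicategoricalIsoComp, Iso.trans_hom, Iso.refl_hom, whiskerLeftIso_hom,
    asIso_hom]
  calc _ = 𝟙 _ ⊗≫ rwhisker L.β (r.v₁ ≫ G₁.w) ⊗≫ 𝟙 _ := by unfold rwhisker; bicategory
    _ = 𝟙 _ ⊗≫ L.v ◁ (leftPasting m n q).hom ⊗≫ 𝟙 _ := by rw [h]
    _ = _ := by
      simp only [leftPasting, bicategoricalIsoComp, Iso.trans_hom, Iso.refl_hom,
        whiskerLeftIso_hom, whiskerRightIso_hom, Iso.symm_hom]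
      bicategory

/-! ### Whiskering with a morphism that is composed last -/

/-- A reduced form of a valid `RightFilling`. -/
structure RightData (C : CChoices W) {X Y Z : K} {F₁ F₂ : Frac W X Y} (r : Rep F₁ F₂)
    (G : Frac W Y Z) where
  pt : K
  a₁ : pt ⟶ (C.sq F₁ G).pt
  a₂ : pt ⟶ (C.sq F₂ G).pt
  b : pt ⟶ r.pt
  η₁ : b ≫ r.v₁ ≅ a₁ ≫ (C.sq F₁ G).fst
  η₂ : b ≫ r.v₂ ≅ a₂ ≫ (C.sq F₂ G).fst
  lam : a₁ ≫ (C.sq F₁ G).snd ⟶ a₂ ≫ (C.sq F₂ G).snd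
  mem : W (a₁ ≫ (C.sq F₁ G).fst ≫ F₁.w)
  valid : rwhisker lam G.w = a₁ ◁ (C.sq F₁ G).iso.inv ≫ rwhisker η₁.inv F₁.f ≫ b ◁ r.β ≫
    rwhisker η₂.hom F₂.f ≫ a₂ ◁ (C.sq F₂ G).iso.hom

namespace RightData

variable {C : CChoices W} {X Y Z : K} {F₁ F₂ : Frac W X Y} {r r' : Rep F₁ F₂} {G : Frac W Y Z}

/-- The representative given by reduced data. -/
def rep (hW : BF W) (P : RightData C r G) : Rep (compFrac hW C F₁ G) (compFrac hW C F₂ G) where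
  pt := P.pt
  v₁ := P.a₁
  v₂ := P.a₂
  α := rwhiskerIso P.η₁.symm F₁.w ≪≫ whiskerLeftIso P.b r.α ≪≫ rwhiskerIso P.η₂ F₂.w
  β := rwhisker P.lam G.f
  mem := P.mem

theorem cell_eq (hW : BF W) (P P' : RightData C r G) : (P.rep hW).cell = (P'.rep hW).cell := by
  obtain ⟨E₁, e, e', κ, he⟩ := (hW.locallyFF_of_mem (compFrac hW C F₁ G).w_mem).exists_refinement
    hW (x := P.a₁) (x' := P'.a₁) P'.mem
  obtain ⟨E₂, d, μ, hd, h₁⟩ := (r.locallyFF₁ hW).exists_sq κ P.η₁.symm P'.η₁.symm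
  -- From `a₁` to `b` through `η₁`, then from `b` to `a₂` through `η₂`. The remaining `lam` may be
  -- non-invertible, but only faithfulness of `G.w` is needed for it.
  obtain ⟨E₃, d', ν, hd', h₂⟩ :=
    (hW.locallyFF_of_mem (C.sq F₂ G).fst_mem).exists_sq μ P.η₂ P'.η₂
  have h₁ := h₁.restrict d'
  have hl : Sq (restrict d' (restrict d κ)) (rwhisker P.lam G.w) (rwhisker P'.lam G.w) ν := by
    rw [P.valid, P'.valid]
    exact .comp (.whiskerLeft _ _) (.comp (h₁.rwhisker _) (.comp (.whiskerLeft _ _)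
      (.comp (h₂.rwhisker _) (.whiskerLeft _ _))))
  obtain ⟨E₄, d'', hd'', hl⟩ := (hW.locallyFF_of_mem G.w_mem).sq_of_rwhisker hl
  exact Rep.cell_eq (r := P.rep hW) (r' := P'.rep hW)
    (hW.bf2 _ _ (hW.bf2 _ _ hd'' (hW.bf2 _ _ hd' (hW.bf2 _ _ hd he))) P.mem)
    (.comp ((h₁.restrict d'').rwhisker F₁.w) (.comp (.whiskerLeft _ _) ((h₂.restrict d'').rwhisker F₂.w)))
    (hl.rwhisker G.f)

/-- Transport of reduced data along a morphism of representatives. -/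
def map (m : r.Hom r') (P : RightData C r G) : RightData C r' G where
  pt := P.pt
  a₁ := P.a₁
  a₂ := P.a₂
  b := P.b ≫ m.z
  η₁ := (m.τ₁Restrict P.b).symm ≪≫ P.η₁
  η₂ := (m.τ₂Restrict P.b).symm ≪≫ P.η₂
  lam := P.lam
  mem := P.mem
  valid := by
    simp only [Iso.trans_hom, Iso.trans_inv, Iso.symm_hom, Iso.symm_inv, rwhisker_comp, Category.assoc,
      reassoc_of% m.rwhisker_τ₁Restrict_β, rwhisker_hom_inv_assoc, P.valid]

theorem cell_map (hW : BF W) (m : r.Hom r') (P : RightData C r G) :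
    (P.rep hW).cell = ((P.map m).rep hW).cell :=
  Rep.cell_congr (by
    change rwhisker P.η₁.inv F₁.w ≫ P.b ◁ r.α.hom ≫ rwhisker P.η₂.hom F₂.w =
      rwhisker ((m.τ₁Restrict P.b).symm ≪≫ P.η₁).inv F₁.w ≫ (P.b ≫ m.z) ◁ r'.α.hom ≫
        rwhisker ((m.τ₂Restrict P.b).symm ≪≫ P.η₂).hom F₂.w
    simp only [Iso.trans_hom, Iso.trans_inv, Iso.symm_hom, Iso.symm_inv, rwhisker_comp,
      Category.assoc, reassoc_of% m.rwhisker_τ₁Restrict_α, rwhisker_hom_inv_assoc]) rfl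

/-- The reduced form of a valid filling. -/
def ofFilling (P : RightFilling C r G) (hP : P.Valid) : RightData C r G where
  pt := P.D₅
  a₁ := P.u₇ ≫ P.u₄
  a₂ := P.u₈ ≫ P.u₆
  b := P.u₈ ≫ P.u₅
  η₁ := whiskerRightIso P.η₃.symm r.v₁ ≪≫ restrictLegs P.u₇ P.η₁
  η₂ := restrictLegs P.u₈ P.η₂
  lam := (α_ _ _ _).hom ≫ P.lam ≫ (α_ _ _ _).inv
  mem := P.mem
  valid := by
    calc _ = 𝟙 _ ⊗≫ P.lam ▷ G.w ⊗≫ 𝟙 _ := by unfold rwhisker; bicategory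
      _ = _ := by
        rw [hP]
        simp only [rwhisker, restrictLegs, Iso.trans_hom, Iso.trans_inv, Iso.symm_hom, Iso.symm_inv,
          whiskerLeftIso_hom, whiskerLeftIso_inv, whiskerRightIso_inv, Category.assoc]
        bicategory

theorem cell_ofFilling (hW : BF W) (P : RightFilling C r G) (hP : P.Valid) :
    (P.rep hW).cell = ((ofFilling P hP).rep hW).cell :=
  Rep.cell_congr
    (by
      change _ = rwhisker (whiskerRightIso P.η₃.symm r.v₁ ≪≫ restrictLegs P.u₇ P.η₁).inv F₁.w ≫
        (P.u₈ ≫ P.u₅) ◁ r.α.hom ≫ rwhisker (restrictLegs P.u₈ P.η₂).hom F₂.w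
      simp only [rwhisker, restrictLegs, bicategoricalIsoComp, Iso.trans_hom, Iso.refl_hom,
        Iso.trans_inv, Iso.symm_inv, whiskerLeftIso_hom, whiskerLeftIso_inv, whiskerRightIso_inv,
        Iso.symm_hom, whiskerRightIso_hom]
      bicategory)
    (by
      simp only [ofFilling, rwhisker]
      bicategory)

end RightData

theorem RightFilling.valid_ofLift (hW : BF W) {C : CChoices W} {X Y Z : K} {F₁ F₂ : Frac W X Y}
    {r : Rep F₁ F₂} {G : Frac W Y Z} (x₁ : OreSquare W r.v₁ (C.sq F₁ G).fst)
    (x₂ : OreSquare W r.v₂ (C.sq F₂ G).fst) (x₃ : OreSquare W x₁.fst x₂.fst)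
    (L : CellLift W G.w (x₃.fst ≫ x₁.snd ≫ (C.sq F₁ G).snd)
      (x₃.snd ≫ x₂.snd ≫ (C.sq F₂ G).snd) (rightPasting x₁ x₂ x₃)) :
    (RightFilling.ofLift hW x₁ x₂ x₃ L).Valid := by
  have h := L.fac_rwhisker
  unfold RightFilling.Valid
  simp only [ofLift, bicategoricalIsoComp, Iso.trans_hom, Iso.refl_hom, whiskerLeftIso_hom]
  calc _ = 𝟙 _ ⊗≫ rwhisker L.β G.w ⊗≫ 𝟙 _ := by unfold rwhisker; bicategory
    _ = 𝟙 _ ⊗≫ L.v ◁ rightPasting x₁ x₂ x₃ ⊗≫ 𝟙 _ := by rw [h]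
    _ = _ := by unfold rightPasting; bicategory

/-! ### Independence of all choices -/

section

variable {A B : K} {F₁ F₂ F₃ : Frac W A B}
  (V : ∀ (r : Rep F₁ F₂) (s : Rep F₂ F₃), VertFilling r s)

/-- The filling for `q` is pushed to `r` and to `r'`, where it may be replaced by the given fillings
because the class does not depend on the filling. -/
theorem VertFilling.cell_eq_of_rel_fst (hW : BF W) {r r' : Rep F₁ F₂} (h : r.Rel r')
    (s : Rep F₂ F₃) : (V r s).rep.cell = (V r' s).rep.cell := by
  obtain ⟨q, ⟨m⟩, ⟨m'⟩⟩ := h.exists_hom hW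
  rw [← cell_eq hW ((V q s).mapFst hW m), ← cell_eq hW ((V q s).mapFst hW m'),
    ← cell_mapFst, ← cell_mapFst]

theorem VertFilling.cell_eq_of_rel_snd (hW : BF W) (r : Rep F₁ F₂) {s s' : Rep F₂ F₃}
    (h : s.Rel s') : (V r s).rep.cell = (V r s').rep.cell := by
  obtain ⟨q, ⟨m⟩, ⟨m'⟩⟩ := h.exists_hom hW
  rw [← cell_eq hW ((V r q).mapSnd m), ← cell_eq hW ((V r q).mapSnd m'),
    ← cell_mapSnd hW, ← cell_mapSnd hW]

end

theorem LeftFilling.cell_eq (hW : BF W) {C : CChoices W} {X Y Z : K} {F : Frac W X Y}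
    {G₁ G₂ : Frac W Y Z} {r : Rep G₁ G₂} {P P' : LeftFilling C F r} (hP : P.Valid)
    (hP' : P'.Valid) : (P.rep hW).cell = (P'.rep hW).cell := by
  rw [LeftData.cell_ofFilling hW _ hP, LeftData.cell_ofFilling hW _ hP']
  exact LeftData.cell_eq hW _ _

theorem LeftFilling.cell_eq_of_rel (hW : BF W) {C : CChoices W} {X Y Z : K} {F : Frac W X Y}
    {G₁ G₂ : Frac W Y Z} (V : ∀ r : Rep G₁ G₂, LeftFilling C F r) (hV : ∀ r, (V r).Valid)
    {r r' : Rep G₁ G₂} (h : r.Rel r') : ((V r).rep hW).cell = ((V r').rep hW).cell := by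
  obtain ⟨q, ⟨m⟩, ⟨m'⟩⟩ := h.exists_hom hW
  -- Transport is done on reduced data, where only `k`, `σ₁` and `σ₂` change.
  let P := LeftData.ofFilling (V q) (hV q)
  rw [LeftData.cell_ofFilling hW _ (hV r), LeftData.cell_ofFilling hW _ (hV r'),
    LeftData.cell_eq hW _ (P.map m), LeftData.cell_eq hW _ (P.map m'), ← P.cell_map, ← P.cell_map]

theorem RightFilling.cell_eq (hW : BF W) {C : CChoices W} {X Y Z : K} {F₁ F₂ : Frac W X Y}
    {r : Rep F₁ F₂} {G : Frac W Y Z} {P P' : RightFilling C r G} (hP : P.Valid)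
    (hP' : P'.Valid) : (P.rep hW).cell = (P'.rep hW).cell := by
  rw [RightData.cell_ofFilling hW _ hP, RightData.cell_ofFilling hW _ hP']
  exact RightData.cell_eq hW _ _

theorem RightFilling.cell_eq_of_rel (hW : BF W) {C : CChoices W} {X Y Z : K}
    {F₁ F₂ : Frac W X Y} {G : Frac W Y Z} (V : ∀ r : Rep F₁ F₂, RightFilling C r G)
    (hV : ∀ r, (V r).Valid) {r r' : Rep F₁ F₂} (h : r.Rel r') :
    ((V r).rep hW).cell = ((V r').rep hW).cell := by
  obtain ⟨q, ⟨m⟩, ⟨m'⟩⟩ := h.exists_hom hW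
  let P := RightData.ofFilling (V q) (hV q)
  rw [RightData.cell_ofFilling hW _ (hV r), RightData.cell_ofFilling hW _ (hV r'),
    RightData.cell_eq hW _ (P.map m), RightData.cell_eq hW _ (P.map m'), ← P.cell_map, ← P.cell_map]

/-! ### Construction and uniqueness of the operations -/

/-- Choices `D(W)` exist. -/
noncomputable def BF.dChoices (hW : BF W) : DChoices W where
  lift u hu f₁ f₂ α := (hW.bf4ab u hu f₁ f₂ α).choose
  isIso_lift u hu f₁ f₂ α := (hW.bf4ab u hu f₁ f₂ α).choose_spec

/-- The operations of the bicategory of fractions, constructed with the choices `D`. -/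
noncomputable def Ops.construct (hW : BF W) (C : CChoices W) (D : DChoices W) : Ops hW C :=
  let vcomp {X Y : K} {F₁ F₂ F₃ : Frac W X Y} : Cell F₁ F₂ → Cell F₂ F₃ → Cell F₁ F₃ :=
    Quot.lift₂ (fun r s => (vertFilling hW C D r s).rep.cell)
      (fun r _ _ h => VertFilling.cell_eq_of_rel_snd (vertFilling hW C D) hW r h)
      (fun _ _ s h => VertFilling.cell_eq_of_rel_fst (vertFilling hW C D) hW h s)
  let whiskerLeft {X Y Z : K} (F : Frac W X Y) {G₁ G₂ : Frac W Y Z} :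
      Cell G₁ G₂ → Cell (compFrac hW C F G₁) (compFrac hW C F G₂) :=
    Quot.lift (fun r => ((leftFilling hW C D F r).rep hW).cell)
      (fun _ _ => LeftFilling.cell_eq_of_rel hW (leftFilling hW C D F)
        fun _ => LeftFilling.valid_ofLift ..)
  let whiskerRight {X Y Z : K} {F₁ F₂ : Frac W X Y} (Φ : Cell F₁ F₂) (G : Frac W Y Z) :
      Cell (compFrac hW C F₁ G) (compFrac hW C F₂ G) :=
    Quot.lift (fun r => ((rightFilling hW C D r G).rep hW).cell)
      (fun _ _ => RightFilling.cell_eq_of_rel hW (rightFilling hW C D · G)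
        fun _ => RightFilling.valid_ofLift ..) Φ
  { id₂ := fun F => (idRep hW F).cell
    vcomp := vcomp
    whiskerLeft := whiskerLeft
    whiskerRight := whiskerRight
    hcomp := fun {_ _ _ _ F₂ G₁ _} Φ Ψ => vcomp (whiskerRight Φ G₁) (whiskerLeft F₂ Ψ)
    associator := fun F G H => (assocFilling hW C D F G H).rep.cell
    leftUnitor := fun F => (leftUnitorRep hW C F).cell
    rightUnitor := fun F => (rightUnitorRep hW C F).cell }

theorem Ops.isConstructed_construct (hW : BF W) (C : CChoices W) (D : DChoices W) :
    (construct hW C D).IsConstructed D := by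
  -- `Quot.lift` computes definitionally on the class of a representative.
  constructor <;> intros <;> rfl

variable {hW : BF W} {C : CChoices W} {S S' : Ops hW C} {D : DChoices W}

theorem Ops.IsConstructed.isChoiceFree (h : S.IsConstructed D) : S.IsChoiceFree where
  vcomp_eq r s _ := (h.vcomp_eq r s).trans (VertFilling.cell_eq hW _ _)
  whiskerLeft_eq F _ _ r _ hP :=
    (h.whiskerLeft_eq F r).trans (LeftFilling.cell_eq hW (LeftFilling.valid_ofLift ..) hP)
  whiskerRight_eq r G _ hP :=
    (h.whiskerRight_eq r G).trans (RightFilling.cell_eq hW (RightFilling.valid_ofLift ..) hP)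
  associator_eq F G H _ hP :=
    (h.associator_eq F G H).trans (AssocFilling.cell_eq (AssocFilling.valid_ofLifts ..) hP)

/-- The fillings made from `D'` are admissible data, so choice-freeness applies to them; the
remaining clauses do not involve `D`. -/
theorem Ops.IsConstructed.change (h : S.IsConstructed D) (D' : DChoices W) :
    S.IsConstructed D' :=
  { h with
    vcomp_eq := fun r s => h.isChoiceFree.vcomp_eq r s _
    whiskerLeft_eq := fun F _ _ r =>
      h.isChoiceFree.whiskerLeft_eq F r _ (LeftFilling.valid_ofLift ..)
    whiskerRight_eq := fun r G =>
      h.isChoiceFree.whiskerRight_eq r G _ (RightFilling.valid_ofLift ..)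
    associator_eq := fun F G H =>
      h.isChoiceFree.associator_eq F G H _ (AssocFilling.valid_ofLifts ..) }

/-- Every 2-morphism is the class of a representative, and on representatives the values are
prescribed. -/
theorem Ops.IsConstructed.unique (h : S.IsConstructed D) (h' : S'.IsConstructed D) : S = S' := by
  have hv : ∀ {X Y : K} {F₁ F₂ F₃ : Frac W X Y} (Φ : Cell F₁ F₂) (Ψ : Cell F₂ F₃),
      S.vcomp Φ Ψ = S'.vcomp Φ Ψ := by
    rintro X Y F₁ F₂ F₃ ⟨r⟩ ⟨s⟩
    exact (h.vcomp_eq r s).trans (h'.vcomp_eq r s).symm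
  have hl : ∀ {X Y Z : K} (F : Frac W X Y) {G₁ G₂ : Frac W Y Z} (Φ : Cell G₁ G₂),
      S.whiskerLeft F Φ = S'.whiskerLeft F Φ := by
    rintro X Y Z F G₁ G₂ ⟨r⟩
    exact (h.whiskerLeft_eq F r).trans (h'.whiskerLeft_eq F r).symm
  have hr : ∀ {X Y Z : K} {F₁ F₂ : Frac W X Y} (Φ : Cell F₁ F₂) (G : Frac W Y Z),
      S.whiskerRight Φ G = S'.whiskerRight Φ G := by
    rintro X Y Z F₁ F₂ ⟨r⟩ G
    exact (h.whiskerRight_eq r G).trans (h'.whiskerRight_eq r G).symm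
  ext
  · rw [h.id₂_eq, h'.id₂_eq]
  · exact hv _ _
  · exact hl _ _
  · exact hr _ _
  · rw [h.hcomp_eq, h'.hcomp_eq, hv, hl, hr]
  · rw [h.associator_eq, h'.associator_eq]
  · rw [h.leftUnitor_eq, h'.leftUnitor_eq]
  · rw [h.rightUnitor_eq, h'.rightUnitor_eq]

end BiFrac

theorem mainTheorem1 {K : Type u} [Bicategory.{w, v} K] (W : MorphismProperty K)
    (hW : BiFrac.BF W) (C : BiFrac.CChoices W) :
    ∃ S : BiFrac.Ops hW C,
      (∀ (D : BiFrac.DChoices W) (S' : BiFrac.Ops hW C), S'.IsConstructed D ↔ S' = S) ∧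
      S.IsChoiceFree := by
  have h := BiFrac.Ops.isConstructed_construct hW C hW.dChoices
  -- The choices `hW.dChoices` only serve to construct `S`; `change` then shows that `S` is also the
  -- structure constructed with any given `D`.
  refine ⟨_, fun D S' => ⟨fun h' => h'.unique (h.change D), ?_⟩, h.isChoiceFree⟩
  rintro rfl
  exact h.change D
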